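/- Let $P,Q\in\mathbb{C}[x,y]$ be polynomials without a common factor, and let $\mathcal{F}$ be the singular holomorphic foliation of $\mathbb{C}P^2$ that extends the foliation of $\mathbb{C}^2$ by the trajectories (with complex time) of the vector field $\dot x=P(x,y)$, $\dot y=Q(x,y)$; its singular set is the finite set of zeros of the homogeneous polynomial $1$-form, with coefficients without a common factor, that defines $\mathcal{F}$ in homogeneous coordinates. (Explicitly, this form is $Q\,dx-P\,dy$ written in homogeneous coordinates, with denominators cleared and common factors of the coefficients removed.) The leaves of $\mathcal{F}$ are the maximal connected (injectively immersed) holomorphic curves in the complement of the singular set that are tangent to $\mathcal{F}$. A leaf is called algebraic if it is the zero locus of some nonzero homogeneous polynomial in the homogeneous coordinates, with the singular points of $\mathcal{F}$ removed. Let $L$ be a non-algebraic leaf of $\mathcal{F}$, and let $T\subset\mathbb{C}P^2$ be a projective line that contains no singular points of $\mathcal{F}$. Then the set $L\cap T$ is infinite. -/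

import Mathlib

open MvPolynomial
open scoped LinearAlgebra.Projectivization

/-- The complex projective plane, with homogeneous coordinates `X 0, X 1, X 2`. The affine plane
`ℂ²` with coordinates `(x, y)` is embedded as `(x, y) ↦ [x : y : 1]`, so that `X 2 = 0` is the
line at infinity. -/
abbrev CP2 : Type := ℙ ℂ (Fin 3 → ℂ)

/-- A polynomial foliation, given by a polynomial vector field `ẋ = P(x, y)`, `ẏ = Q(x, y)` on `ℂ²`
whose components have no common factor. -/
structure PolynomialFoliation where
  P : MvPolynomial (Fin 2) ℂ
  Q : MvPolynomial (Fin 2) ℂ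
  coprime : IsRelPrime P Q

/-- The homogenization `Z ^ n * p (X / Z, Y / Z)` of a polynomial `p` of total degree at most `n`,
where `X, Y, Z` are the variables with indices `0, 1, 2`. -/
noncomputable def homogenizeTo (n : ℕ) (p : MvPolynomial (Fin 2) ℂ) : MvPolynomial (Fin 3) ℂ :=
  ∑ i ∈ Finset.range (n + 1),
    X 2 ^ (n - i) * rename Fin.castSucc (homogeneousComponent i p)

namespace PolynomialFoliation

/-- The degree `max (deg P) (deg Q)` of the vector field. -/
noncomputable def degree (F : PolynomialFoliation) : ℕ :=
  max F.P.totalDegree F.Q.totalDegree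

/-- The polynomial `Y * P̃ - X * Q̃`, where `P̃, Q̃` are `P, Q` homogenized to the degree of the
vector field. -/
noncomputable def infinityPoly (F : PolynomialFoliation) : MvPolynomial (Fin 3) ℂ :=
  X 1 * homogenizeTo F.degree F.P - X 0 * homogenizeTo F.degree F.Q

open Classical in
/-- The coefficients of `dX, dY, dZ` in the homogeneous 1-form on `ℂ³` that defines the extension of
the foliation to `CP2`. The form `Q dx - P dy` with `x = X / Z`, `y = Y / Z`, multiplied by
`Z ^ (n + 2)`, is `Z Q̃ dX - Z P̃ dY + (Y P̃ - X Q̃) dZ`. If `Z` divides `Y P̃ - X Q̃`, then the whole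
form is divisible by `Z`, and it is divided by `Z`; after that the three coefficients have no
common factor. -/
noncomputable def form (F : PolynomialFoliation) : Fin 3 → MvPolynomial (Fin 3) ℂ :=
  if h : X 2 ∣ F.infinityPoly then
    ![homogenizeTo F.degree F.Q, -homogenizeTo F.degree F.P, h.choose]
  else
    ![X 2 * homogenizeTo F.degree F.Q, -(X 2 * homogenizeTo F.degree F.P), F.infinityPoly]

/-- The singular points of the foliation in `CP2`: the points where its form vanishes. -/
def singularSet (F : PolynomialFoliation) : Set CP2 :=
  {p | ∀ i, eval p.rep (F.form i) = 0}

/-- A holomorphic curve in homogeneous coordinates, parametrized by the unit disc, that consists of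
non-singular points and is everywhere tangent to the foliation. -/
structure IsTangentDisc (F : PolynomialFoliation) (γ : ℂ → Fin 3 → ℂ) : Prop where
  differentiableOn : DifferentiableOn ℂ γ (Metric.ball 0 1)
  ne_zero : ∀ t ∈ Metric.ball (0 : ℂ) 1, γ t ≠ 0
  regular : ∀ t ∈ Metric.ball (0 : ℂ) 1, ∃ i, eval (γ t) (F.form i) ≠ 0
  tangent : ∀ t ∈ Metric.ball (0 : ℂ) 1, ∑ i, eval (γ t) (F.form i) * deriv γ t i = 0

/-- The points `p` and `q` of `CP2` lie on a common tangent disc of the foliation. -/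
def OnCommonDisc (F : PolynomialFoliation) (p q : CP2) : Prop :=
  ∃ γ : ℂ → Fin 3 → ℂ, F.IsTangentDisc γ ∧
    (∃ s ∈ Metric.ball (0 : ℂ) 1, ∃ h : γ s ≠ 0, Projectivization.mk ℂ (γ s) h = p) ∧
    (∃ t ∈ Metric.ball (0 : ℂ) 1, ∃ h : γ t ≠ 0, Projectivization.mk ℂ (γ t) h = q)

/-- The leaf through a non-singular point `p`: all the points that can be joined to `p` by a finite
chain of tangent discs. -/
def leaf (F : PolynomialFoliation) (p : CP2) : Set CP2 :=
  {q | Relation.ReflTransGen F.OnCommonDisc p q}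

/-- The leaves of the foliation in `CP2`. -/
def IsLeaf (F : PolynomialFoliation) (L : Set CP2) : Prop :=
  ∃ p, p ∉ F.singularSet ∧ L = F.leaf p

/-- A leaf is algebraic if it is, up to singular points of the foliation, the zero locus of a nonzero
homogeneous polynomial. -/
def IsAlgebraicLeaf (F : PolynomialFoliation) (L : Set CP2) : Prop :=
  F.IsLeaf L ∧ ∃ (G : MvPolynomial (Fin 3) ℂ) (d : ℕ), G ≠ 0 ∧ G.IsHomogeneous d ∧
    L = {p | eval p.rep G = 0} \ F.singularSet

end PolynomialFoliation

/-- The set of points of `CP2` that lie in a linear subspace `W` of `ℂ³`; it is a projective line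
if `W` has dimension two. -/
def projectiveLocus (W : Submodule ℂ (Fin 3 → ℂ)) : Set CP2 :=
  {p | p.submodule ≤ W}

/-- The projective lines in `CP2`. -/
def IsProjectiveLine (T : Set CP2) : Prop :=
  ∃ W : Submodule ℂ (Fin 3 → ℂ), Module.finrank ℂ W = 2 ∧ T = projectiveLocus W

/-! Suppose that `L ∩ T` is finite; then `L` is shown to be algebraic. Let `ω` be the form of the
foliation, `d` its degree, `l` the equation of `T`, and `Λ ⊂ ℂ³` the cone over `L`.

Local picture at `T` (`exists_plaque_on_line`, `exists_branch`). The line `T` is not invariant, so a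
plaque through a point `p ∈ T` of the closure of `L` meets `T` in isolated points, and by the open
mapping theorem all nearby plaques of `L` meet `T` near `p`. Finiteness forces them to coincide:
near `p` the leaf is a single plaque, with a finite order of contact `m` with `T`.

Maximum principle (`eval_eq_zero_of_tendsto`). For `G` homogeneous of degree `N` and `k = N + d +
1`, the functions `G ωᵢ Xⱼ / l ^ k` have degree zero. If `G` vanishes on every branch to order above
`k m`, they extend by zero across `T`, and the norm of the vector they form has a maximum on the
compact closure of `L`. The closure contains a plaque through each of its regular points, so a
nonzero maximum would make the vector constant along a plaque, which the factors `Xⱼ` exclude. Hence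
`G` vanishes on `L`.

Algebraicity (`exists_algebraic_equation`). The vanishing conditions grow linearly in `N`, with
slope `n = ∑ m`, while the space of forms grows quadratically, so some `G ≠ 0` vanishes on `L`. One
of least degree `D` divides all the others, and comparing codimensions gives `D ≤ n`. So `G`
restricted to `T` has no zeros besides the `n` prescribed by `L`. As `G` divides `dG ∧ ω`, the curve
`G = 0` is invariant; its regular part outside `L` is saturated and misses `T`, and the maximum
principle with `G = 1` shows that it is empty. -/

/-! ### Holomorphic ordinary differential equations -/

open Metric Filter Topology in
/-- Holomorphic solutions of a scalar equation `v' = F(u, v)` near the origin: local existence on a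
disc of uniform radius, and Lipschitz dependence on the initial value. -/
theorem exists_holomorphic_solutions {F : ℂ × ℂ → ℂ} (hF : AnalyticAt ℂ F 0) {S : Set (ℂ × ℂ)}
    (hS : S ∈ 𝓝 (0 : ℂ × ℂ)) :
    ∃ r > 0, ∃ ρ > 0, (∀ u v : ℂ, ‖u‖ < r → ‖v‖ < ρ → (u, v) ∈ S) ∧
      (∃ δ > 0, δ ≤ r ∧ ∀ u₀ v₀ : ℂ, ‖u₀‖ < δ → ‖v₀‖ < δ → ∃ f : ℂ → ℂ, f u₀ = v₀ ∧
        ∀ u, ‖u‖ < r → ‖f u‖ < ρ ∧ HasDerivAt f (F (u, f u)) u) ∧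
      ∀ f g : ℂ → ℂ, (∀ u, ‖u‖ < r → ‖f u‖ < ρ ∧ HasDerivAt f (F (u, f u)) u) →
        (∀ u, ‖u‖ < r → ‖g u‖ < ρ ∧ HasDerivAt g (F (u, g u)) u) →
        ∀ u₀ u, ‖u₀‖ < r → ‖u‖ < r → ‖f u - g u‖ ≤ 2 * ‖f u₀ - g u₀‖ := by
  have hd : ∀ᶠ z in 𝓝 (0 : ℂ × ℂ), DifferentiableAt ℂ F z :=
    hF.eventually_analyticAt.mono fun z hz => hz.differentiableAt
  obtain ⟨K, t, ht, hK⟩ := (hF.contDiffAt (n := 1)).exists_lipschitzOnWith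
  have hb : ∀ᶠ z in 𝓝 (0 : ℂ × ℂ), ‖F z‖ < ‖F 0‖ + 1 :=
    hF.continuousAt.norm.eventually (gt_mem_nhds (by linarith))
  obtain ⟨ρ, hρ, hball⟩ := Metric.eventually_nhds_iff_ball.1
    (hd.and (hb.and ((eventually_mem_set.2 ht).and (eventually_mem_set.2 hS))))
  have hmem : ∀ u v : ℂ, ‖u‖ < ρ → ‖v‖ < ρ → (u, v) ∈ ball (0 : ℂ × ℂ) ρ := by
    intro u v hu hv
    simp [Prod.norm_def, hu, hv]
  set M : ℝ := ‖F 0‖ + 1 with hM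
  have hM0 : 0 < M := by positivity
  -- Two points of the disc are at distance at most `2 r`. The bound with `M` keeps Picard iterates
  -- starting in `ρ / 4` inside `ρ / 2`; the bound with `K` makes the Picard operator contract by `1
  -- / 2`.
  obtain ⟨r, hr, hrρ, hrM, hrK⟩ : ∃ r > 0, r ≤ ρ ∧ M * (2 * r) ≤ ρ / 4 ∧ K * (2 * r) ≤ 1 / 2 := by
    refine ⟨min ρ (min (ρ / (8 * M)) (1 / (4 * (K + 1)))), by positivity, min_le_left _ _, ?_, ?_⟩
    · have : min ρ (min (ρ / (8 * M)) (1 / (4 * ((K : ℝ) + 1)))) ≤ ρ / (8 * M) :=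
        (min_le_right _ _).trans (min_le_left _ _)
      calc M * (2 * _) ≤ M * (2 * (ρ / (8 * M))) := by gcongr
        _ = ρ / 4 := by field_simp; ring
    · have : min ρ (min (ρ / (8 * M)) (1 / (4 * ((K : ℝ) + 1)))) ≤ 1 / (4 * ((K : ℝ) + 1)) :=
        (min_le_right _ _).trans (min_le_right _ _)
      calc (K : ℝ) * (2 * _) ≤ (K + 1) * (2 * (1 / (4 * ((K : ℝ) + 1)))) := by gcongr; simp
        _ = 1 / 2 := by field_simp; norm_num
  have hlip : ∀ u v w : ℂ, ‖u‖ < r → ‖v‖ < ρ → ‖w‖ < ρ → ‖F (u, v) - F (u, w)‖ ≤ K * ‖v - w‖ := by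
    intro u v w hu hv hw
    have h1 := (hball _ (hmem u v (hu.trans_le hrρ) hv)).2.2.1
    have h2 := (hball _ (hmem u w (hu.trans_le hrρ) hw)).2.2.1
    have := hK.dist_le_mul _ h1 _ h2
    simpa [dist_eq_norm, Prod.norm_def] using this
  have hdist : ∀ u u₀ : ℂ, ‖u‖ < r → ‖u₀‖ < r → ‖u - u₀‖ ≤ 2 * r := by
    intro u u₀ h1 h2
    linarith [norm_sub_le u u₀]
  have hmv : ∀ (h h' : ℂ → ℂ) (C : ℝ), (∀ u, ‖u‖ < r → HasDerivAt h (h' u) u) →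
      (∀ u, ‖u‖ < r → ‖h' u‖ ≤ C) → ∀ u₀ u, ‖u₀‖ < r → ‖u‖ < r →
        ‖h u - h u₀‖ ≤ C * (2 * r) := by
    intro h h' C h1 h2 u₀ u hu₀ hu
    have hC : 0 ≤ C := (norm_nonneg _).trans (h2 u hu)
    have := (convex_ball (0 : ℂ) r).norm_image_sub_le_of_norm_hasDerivWithin_le (f := h) (f' := h')
      (C := C) (fun x hx => (h1 x (by simpa using hx)).hasDerivWithinAt)
      (fun x hx => h2 x (by simpa using hx)) (x := u₀) (y := u) (by simpa using hu₀)
      (by simpa using hu)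
    exact this.trans (by gcongr; exact hdist _ _ hu hu₀)
  refine ⟨r, hr, ρ, hρ, fun u v hu hv => (hball _ (hmem u v (hu.trans_le hrρ) hv)).2.2.2,
    ⟨min r (ρ / 4), by positivity, min_le_left _ _, ?_⟩, ?_⟩
  · intro u₀ v₀ hu₀ hv₀
    have hu₀ : ‖u₀‖ < r := hu₀.trans_le (min_le_left _ _)
    have hv₀ : ‖v₀‖ < ρ / 4 := hv₀.trans_le (min_le_right _ _)
    let X := {g : ℂ → ℂ // DifferentiableOn ℂ g (ball 0 r) ∧ ∀ u, ‖u‖ < r → ‖g u‖ ≤ ρ / 2}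
    have hstep : ∀ g : X, ∃ h : X, h.1 u₀ = v₀ ∧ ∀ u, ‖u‖ < r → HasDerivAt h.1 (F (u, g.1 u)) u := by
      rintro ⟨g, hg, hgb⟩
      have hgρ : ∀ u, ‖u‖ < r → ‖g u‖ < ρ := fun u hu => (hgb u hu).trans_lt (by linarith)
      have hdiff : DifferentiableOn ℂ (fun u => F (u, g u)) (ball 0 r) := by
        intro u hu
        have hu' : ‖u‖ < r := by simpa using hu
        have h1 := (hball _ (hmem u (g u) (hu'.trans_le hrρ) (hgρ u hu'))).1
        exact h1.comp_differentiableWithinAt u (differentiableWithinAt_id.prodMk (hg u hu))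
      -- A primitive on the disc plays the role of the integral in Picard iteration.
      obtain ⟨h, h0, hh⟩ := hdiff.isExactOn_ball.with_val_at u₀ v₀
      have hh' : ∀ u, ‖u‖ < r → HasDerivAt h (F (u, g u)) u := fun u hu => hh u (by simpa using hu)
      refine ⟨⟨h, fun u hu => (hh u hu).differentiableAt.differentiableWithinAt, ?_⟩, h0, hh'⟩
      intro u hu
      have := hmv h _ M hh'
        (fun u hu => (hball _ (hmem u (g u) (hu.trans_le hrρ) (hgρ u hu))).2.1.le) u₀ u hu₀ hu
      rw [h0] at this
      linarith [norm_le_norm_sub_add (h u) v₀]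
    choose T hT0 hTd using hstep
    let f : ℕ → X := fun n => T^[n] ⟨fun _ => v₀, differentiableOn_const _, fun _ _ => by
      change ‖v₀‖ ≤ _; linarith⟩
    have hfs : ∀ n, f (n + 1) = T (f n) := fun n => Function.iterate_succ_apply' _ _ _
    have hlt : ∀ (g : X) u, ‖u‖ < r → ‖g.1 u‖ < ρ := fun g u hu =>
      (g.2.2 u hu).trans_lt (by linarith)
    have hcontr : ∀ n u, ‖u‖ < r → ‖(f (n + 1)).1 u - (f n).1 u‖ ≤ ρ * (1 / 2) ^ n := by
      intro n
      induction n with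
      | zero =>
        intro u hu
        have h1 := (f 1).2.2 u hu
        have h2 := (f 0).2.2 u hu
        simpa using (norm_sub_le _ _).trans (by linarith : _ ≤ ρ)
      | succ n ih =>
        intro u hu
        have hd : ∀ u, ‖u‖ < r → HasDerivAt (fun u => (f (n + 2)).1 u - (f (n + 1)).1 u)
            (F (u, (f (n + 1)).1 u) - F (u, (f n).1 u)) u := by
          intro u hu
          have h1 := hTd (f (n + 1)) u hu
          have h2 := hTd (f n) u hu
          rw [← hfs] at h1 h2
          exact h1.sub h2
        have := hmv _ _ (K * (ρ * (1 / 2) ^ n)) hd (fun u hu =>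
          (hlip u _ _ hu (hlt _ u hu) (hlt _ u hu)).trans (by gcongr; exact ih u hu)) u₀ u hu₀ hu
        have e1 : (f (n + 2)).1 u₀ = v₀ := by rw [hfs]; exact hT0 _
        have e2 : (f (n + 1)).1 u₀ = v₀ := by rw [hfs]; exact hT0 _
        simp only [e1, e2, sub_self, sub_zero] at this
        refine this.trans ?_
        have h3 : 0 ≤ ρ * (1 / 2 : ℝ) ^ n := by positivity
        calc K * (ρ * (1 / 2) ^ n) * (2 * r) = (K * (2 * r)) * (ρ * (1 / 2) ^ n) := by ring
          _ ≤ 1 / 2 * (ρ * (1 / 2) ^ n) := by gcongr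
          _ = ρ * (1 / 2) ^ (n + 1) := by ring
    have hlim : ∀ u, ∃ l, ‖u‖ < r → Tendsto (fun n => (f n).1 u) atTop (𝓝 l) := by
      intro u
      by_cases hu : ‖u‖ < r
      · have hc : CauchySeq fun n => (f n).1 u :=
          cauchySeq_of_le_geometric (1 / 2) ρ (by norm_num) fun n => by
            rw [dist_comm, dist_eq_norm]; exact hcontr n u hu
        exact ⟨_, fun _ => hc.tendsto_limUnder⟩
      · exact ⟨0, fun h => absurd h hu⟩
    choose g hg using hlim
    have hunif : TendstoUniformlyOn (fun n => (f n).1) g atTop (ball 0 r) := by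
      rw [Metric.tendstoUniformlyOn_iff]
      intro ε hε
      have : Tendsto (fun n : ℕ => ρ * (1 / 2 : ℝ) ^ n / (1 - 1 / 2)) atTop (𝓝 0) := by
        have := (tendsto_pow_atTop_nhds_zero_of_lt_one (r := (1 / 2 : ℝ)) (by norm_num)
          (by norm_num)).const_mul ρ |>.div_const (1 - 1 / 2 : ℝ)
        simpa using this
      filter_upwards [this.eventually (gt_mem_nhds hε)] with n hn u hu
      rw [dist_comm]
      have hu : ‖u‖ < r := by simpa using hu
      exact (dist_le_of_le_geometric_of_tendsto (1 / 2) ρ (by norm_num) (fun n => by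
            rw [dist_comm, dist_eq_norm]; exact hcontr n u hu) (hg u hu) n).trans_lt hn
    have hloc := hunif.tendstoLocallyUniformlyOn
    have hgd : DifferentiableOn ℂ g (ball 0 r) :=
      hloc.differentiableOn (Eventually.of_forall fun n => (f n).2.1) isOpen_ball
    have hgb : ∀ u, ‖u‖ < r → ‖g u‖ < ρ := fun u hu =>
      (le_of_tendsto (hg u hu).norm (Eventually.of_forall fun n => (f n).2.2 u hu)).trans_lt
        (by linarith)
    refine ⟨g, ?_, fun u hu => ⟨hgb u hu, ?_⟩⟩
    · refine tendsto_nhds_unique ((hg u₀ hu₀).comp (tendsto_add_atTop_nat 1)) ?_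
      refine tendsto_const_nhds.congr fun n => ?_
      simp only [Function.comp, hfs, hT0]
    · have hu' : u ∈ ball (0 : ℂ) r := by simpa using hu
      have h1 : Tendsto (fun n => deriv (f n).1 u) atTop (𝓝 (deriv g u)) :=
        (hloc.deriv (Eventually.of_forall fun n => (f n).2.1) isOpen_ball).tendsto_at hu'
      have h2 : Tendsto (fun n => F (u, (f n).1 u)) atTop (𝓝 (F (u, g u))) := by
        have hc : ContinuousAt F (u, g u) :=
          (hball _ (hmem u (g u) (hu.trans_le hrρ) (hgb u hu))).1.continuousAt
        exact hc.tendsto.comp (tendsto_const_nhds.prodMk_nhds (hg u hu))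
      have h3 : deriv g u = F (u, g u) := by
        refine tendsto_nhds_unique (h1.comp (tendsto_add_atTop_nat 1)) (h2.congr fun n => ?_)
        simp only [Function.comp, hfs]
        exact (hTd (f n) u hu).deriv.symm
      rw [← h3]
      exact ((hgd u hu').differentiableAt (isOpen_ball.mem_nhds hu')).hasDerivAt
  · intro f g hf hg u₀ u hu₀ hu
    -- One application of the mean value inequality improves a bound `C` to `a + C / 2`, where `a`
    -- is the difference at `u₀`. The iterates converge to the fixed point `2 a`, whence the
    -- constant 2.
    have hbd : ∀ C : ℝ, (∀ u, ‖u‖ < r → ‖f u - g u‖ ≤ C) →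
        ∀ u, ‖u‖ < r → ‖f u - g u‖ ≤ ‖f u₀ - g u₀‖ + C / 2 := by
      intro C hC u hu
      have hC0 : 0 ≤ C := (norm_nonneg _).trans (hC u hu)
      have := hmv (fun u => f u - g u) (fun u => F (u, f u) - F (u, g u)) (K * C)
        (fun u hu => (hf u hu).2.sub (hg u hu).2)
        (fun u hu => (hlip u _ _ hu (hf u hu).1 (hg u hu).1).trans (by gcongr; exact hC u hu))
        u₀ u hu₀ hu
      have h2 : K * C * (2 * r) ≤ C / 2 := by
        calc K * C * (2 * r) = (K * (2 * r)) * C := by ring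
          _ ≤ 1 / 2 * C := by gcongr
          _ = C / 2 := by ring
      linarith [norm_le_norm_sub_add (f u - g u) (f u₀ - g u₀)]
    have hiter : ∀ n : ℕ, ∀ u, ‖u‖ < r →
        ‖f u - g u‖ ≤ 2 * ‖f u₀ - g u₀‖ + 2 * ρ * (1 / 2) ^ n := by
      intro n
      induction n with
      | zero =>
        intro u hu
        have h1 := (hf u hu).1
        have h2 := (hg u hu).1
        have h3 := norm_sub_le (f u) (g u)
        have h4 := norm_nonneg (f u₀ - g u₀)
        simp only [pow_zero, mul_one]
        linarith
      | succ n ih =>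
        intro u hu
        refine (hbd _ ih u hu).trans (le_of_eq ?_)
        ring
    have hlim : Tendsto (fun n : ℕ => 2 * ‖f u₀ - g u₀‖ + 2 * ρ * (1 / 2) ^ n) atTop
        (𝓝 (2 * ‖f u₀ - g u₀‖ + 2 * ρ * 0)) :=
      tendsto_const_nhds.add ((tendsto_pow_atTop_nhds_zero_of_lt_one (by norm_num)
        (by norm_num)).const_mul _)
    rw [mul_zero, add_zero] at hlim
    exact ge_of_tendsto' hlim fun n => hiter n u hu

/-! ### Homogeneous polynomials and plane curves -/

section HomogeneousPolynomials

variable {σ : Type*}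

/-- The ring homomorphism `p ↦ p (T X)`, which records the homogeneous components of `p` as
coefficients of powers of `T`. -/
noncomputable def scaleHom (σ : Type*) :
    MvPolynomial σ ℂ →ₐ[ℂ] Polynomial (MvPolynomial σ ℂ) :=
  aeval fun i => Polynomial.C (X i) * Polynomial.X

theorem scaleHom_monomial (d : σ →₀ ℕ) (c : ℂ) :
    scaleHom σ (monomial d c) = Polynomial.monomial d.degree (monomial d c) := by
  rw [scaleHom, aeval_monomial]
  simp only [mul_pow, Finsupp.prod_mul]
  rw [← Polynomial.C_mul_X_pow_eq_monomial, monomial_eq (s := d) (a := c), map_mul]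
  have h1 : (d.prod fun _ k => (Polynomial.X : Polynomial (MvPolynomial σ ℂ)) ^ k)
      = Polynomial.X ^ d.degree := by
    rw [Finsupp.prod, Finset.prod_pow_eq_pow_sum]; rfl
  have h2 : (d.prod fun i k => (Polynomial.C (X i : MvPolynomial σ ℂ)) ^ k)
      = Polynomial.C (d.prod fun i k => (X i : MvPolynomial σ ℂ) ^ k) := by
    simp only [Finsupp.prod, map_prod, map_pow]
  rw [h1, h2, ← mul_assoc]
  rfl

theorem scaleHom_coeff (p : MvPolynomial σ ℂ) (n : ℕ) :
    (scaleHom σ p).coeff n = homogeneousComponent n p := by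
  induction p using MvPolynomial.induction_on' with
  | monomial d c =>
    rw [scaleHom_monomial, Polynomial.coeff_monomial]
    by_cases h : d.degree = n
    · rw [if_pos h, homogeneousComponent_of_mem (isHomogeneous_monomial c h), if_pos rfl]
    · rw [if_neg h, homogeneousComponent_of_mem (isHomogeneous_monomial c rfl), if_neg (Ne.symm h)]
  | add p q hp hq => simp [hp, hq]

/-- The factors of a nonzero homogeneous polynomial are homogeneous. -/
theorem MvPolynomial.IsHomogeneous.exists_of_mul {p q : MvPolynomial σ ℂ} {n : ℕ}
    (h : (p * q).IsHomogeneous n) (h0 : p * q ≠ 0) :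
    ∃ k l, k + l = n ∧ p.IsHomogeneous k ∧ q.IsHomogeneous l := by
  have hinj : ∀ r : MvPolynomial σ ℂ, r ≠ 0 → scaleHom σ r ≠ 0 := by
    intro r hr h0
    apply hr
    rw [← sum_homogeneousComponent r]
    exact Finset.sum_eq_zero fun i _ => by rw [← scaleHom_coeff, h0, Polynomial.coeff_zero]
  have hp := hinj p (left_ne_zero_of_mul h0)
  have hq := hinj q (right_ne_zero_of_mul h0)
  have hpq : scaleHom σ (p * q) = Polynomial.monomial n (p * q) := by
    ext1 m
    rw [scaleHom_coeff, homogeneousComponent_of_mem h, Polynomial.coeff_monomial]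
    simp only [eq_comm]
  have hmul : scaleHom σ p * scaleHom σ q = Polynomial.monomial n (p * q) := by
    rw [← map_mul, hpq]
  -- Degree and trailing degree in `T` are both additive. They agree for the product, a monomial in
  -- `T`, hence for each factor.
  have hdeg := Polynomial.natDegree_mul hp hq
  have htr := Polynomial.natTrailingDegree_mul hp hq
  rw [hmul, Polynomial.natDegree_monomial_eq n h0] at hdeg
  rw [hmul, Polynomial.natTrailingDegree_monomial h0] at htr
  have h1 := Polynomial.natTrailingDegree_le_natDegree (scaleHom σ p)
  have h2 := Polynomial.natTrailingDegree_le_natDegree (scaleHom σ q)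
  have key : ∀ r : MvPolynomial σ ℂ,
      (scaleHom σ r).natTrailingDegree = (scaleHom σ r).natDegree →
      r.IsHomogeneous (scaleHom σ r).natDegree := by
    intro r hr
    have : r = homogeneousComponent (scaleHom σ r).natDegree r := by
      conv_lhs => rw [← sum_homogeneousComponent r]
      rw [Finset.sum_eq_single (scaleHom σ r).natDegree]
      · intro i _ hi
        rw [← scaleHom_coeff]
        rcases lt_or_gt_of_ne hi with h | h
        · exact Polynomial.coeff_eq_zero_of_lt_natTrailingDegree (hr ▸ h)
        · exact Polynomial.coeff_eq_zero_of_natDegree_lt h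
      · intro hi
        refine homogeneousComponent_eq_zero _ _ ?_
        simpa using hi
    rw [this]
    nth_rewrite 2 [← this]
    exact homogeneousComponent_isHomogeneous _ _
  exact ⟨_, _, hdeg.symm, key p (by omega), key q (by omega)⟩

theorem MvPolynomial.IsHomogeneous.eval_smul {p : MvPolynomial σ ℂ} {n : ℕ}
    (h : p.IsHomogeneous n) (c : ℂ) (x : σ → ℂ) : eval (c • x) p = c ^ n * eval x p := by
  rw [eval_eq, eval_eq, Finset.mul_sum]
  refine Finset.sum_congr rfl fun d hd => ?_
  simp only [Pi.smul_apply, smul_eq_mul, mul_pow, Finset.prod_mul_distrib,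
    Finset.prod_pow_eq_pow_sum]
  rw [← h.degree_eq_sum_deg_support hd]
  ring

theorem finrank_homogeneousSubmodule (N : ℕ) :
    2 * Module.finrank ℂ (homogeneousSubmodule (Fin 3) ℂ N) = (N + 1) * (N + 2) := by
  have hs : {d : Fin 3 →₀ ℕ | d.degree = N} =
      ((Finset.univ : Finset (Fin 3)).finsuppAntidiag N : Set (Fin 3 →₀ ℕ)) := by
    ext d
    simp [Finset.mem_finsuppAntidiag, Finsupp.degree_eq_sum]
  rw [homogeneousSubmodule_eq_finsupp_supported, hs,
    (AddMonoidAlgebra.supportedEquivFinsupp (R := ℂ) (S := ℂ) _).finrank_eq]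
  rw [Module.finrank_finsupp_self]
  change 2 * Fintype.card (Finset.univ.finsuppAntidiag N) = _
  rw [Fintype.card_coe, Finset.card_finsuppAntidiag_nat_eq_choose]
  simp only [Finset.card_univ, Fintype.card_fin]
  rw [show 3 + N - 1 = N + 2 by omega, Nat.choose_symm_add, Nat.choose_two_right,
    Nat.mul_div_cancel' (Nat.even_mul_pred_self _).two_dvd]
  simp [mul_comm]

instance finiteDimensional_homogeneousSubmodule (N : ℕ) :
    Module.Finite ℂ (homogeneousSubmodule (Fin 3) ℂ N) :=
  Module.Finite.iff_fg.2 (homogeneousSubmodule_fg _ _ _)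

/-- The multiples of `G` by homogeneous polynomials of degree `N`. -/
noncomputable def multiples (G : MvPolynomial (Fin 3) ℂ) (N : ℕ) :
    Submodule ℂ (MvPolynomial (Fin 3) ℂ) :=
  (homogeneousSubmodule (Fin 3) ℂ N).map (LinearMap.mulLeft ℂ G)

theorem mem_multiples {G p : MvPolynomial (Fin 3) ℂ} {N : ℕ} :
    p ∈ multiples G N ↔ ∃ q : MvPolynomial (Fin 3) ℂ, q.IsHomogeneous N ∧ G * q = p := Iff.rfl

instance finiteDimensional_multiples (G : MvPolynomial (Fin 3) ℂ) (N : ℕ) :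
    Module.Finite ℂ (multiples G N) :=
  inferInstanceAs (Module.Finite ℂ ((homogeneousSubmodule (Fin 3) ℂ N).map _))

theorem finrank_multiples {G : MvPolynomial (Fin 3) ℂ} (hG : G ≠ 0) (N : ℕ) :
    Module.finrank ℂ (multiples G N) = Module.finrank ℂ (homogeneousSubmodule (Fin 3) ℂ N) :=
  (Submodule.equivMapOfInjective _ (fun _ _ h => mul_left_cancel₀ hG h) _).finrank_eq.symm

/-- A homogeneous polynomial that is a multiple of `G` has a homogeneous cofactor. -/
theorem mem_multiples_of_dvd {G H : MvPolynomial (Fin 3) ℂ} {D N : ℕ} (hG : G.IsHomogeneous D)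
    (hH : H.IsHomogeneous (D + N)) (h : G ∣ H) : H ∈ multiples G N := by
  obtain ⟨q, rfl⟩ := h
  by_cases h0 : G * q = 0
  · rw [h0]; exact zero_mem _
  · obtain ⟨k, l, hkl, hk, hl⟩ := hH.exists_of_mul h0
    have := hk.inj_right hG (left_ne_zero_of_mul h0)
    obtain rfl : l = N := by omega
    exact mem_multiples.2 ⟨q, hl, rfl⟩

/-- Two distinct points of the projective plane are separated by a linear form. -/
theorem exists_linear_separating {p q : CP2} (h : p ≠ q) :
    ∃ l : MvPolynomial (Fin 3) ℂ, l.IsHomogeneous 1 ∧ eval p.rep l ≠ 0 ∧ eval q.rep l = 0 := by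
  by_contra! hc
  apply h
  obtain ⟨m, hm⟩ := Function.ne_iff.1 q.rep_nonzero
  have hm : q.rep m ≠ 0 := hm
  have key : ∀ i, p.rep i * q.rep m = p.rep m * q.rep i := by
    intro i
    by_contra hne
    refine hc (C (q.rep m) * X i - C (q.rep i) * X m)
      ((isHomogeneous_C_mul_X _ _).sub (isHomogeneous_C_mul_X _ _)) ?_ ?_
    · simp only [map_sub, map_mul, eval_C, eval_X]
      exact fun h => hne (by linear_combination h)
    · simp only [map_sub, map_mul, eval_C, eval_X]; ring
  rw [← p.mk_rep, ← q.mk_rep, Projectivization.mk_eq_mk_iff']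
  refine ⟨p.rep m / q.rep m, ?_⟩
  ext i
  have := key i
  simp only [Pi.smul_apply, smul_eq_mul]
  field_simp
  linear_combination -this

/-- In high degree, homogeneous polynomials take arbitrary values at finitely many points. -/
theorem exists_homogeneous_separating (s : Finset CP2) (p : CP2) {N : ℕ}
    (hN : s.card ≤ N) :
    ∃ G : MvPolynomial (Fin 3) ℂ, G.IsHomogeneous N ∧ eval p.rep G ≠ 0 ∧
      ∀ q ∈ s, q ≠ p → eval q.rep G = 0 := by
  classical
  -- For `q = p` any form that is nonzero at `p` will do, so the product over `s` has degree
  -- `s.card` whether or not `p ∈ s`; a power of `l p` then fills up the degree.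
  have hl : ∀ q : CP2, ∃ l : MvPolynomial (Fin 3) ℂ, l.IsHomogeneous 1 ∧ eval p.rep l ≠ 0 ∧
      (q ≠ p → eval q.rep l = 0) := by
    intro q
    by_cases h : q = p
    · obtain ⟨m, hm⟩ := Function.ne_iff.1 p.rep_nonzero
      exact ⟨X m, isHomogeneous_X _ _, by simpa using hm, fun h' => absurd h h'⟩
    · obtain ⟨l, h1, h2, h3⟩ := exists_linear_separating (Ne.symm h)
      exact ⟨l, h1, h2, fun _ => h3⟩
  choose l h1 h2 h3 using hl
  refine ⟨(∏ q ∈ s, l q) * l p ^ (N - s.card), ?_, ?_, ?_⟩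
  · have := (IsHomogeneous.prod s l (fun _ => 1) fun q _ => h1 q).mul ((h1 p).pow (N - s.card))
    simpa [Nat.add_sub_cancel' hN] using this
  · simp only [map_mul, map_prod, map_pow]
    exact mul_ne_zero (Finset.prod_ne_zero_iff.2 fun q _ => h2 q) (pow_ne_zero _ (h2 p))
  · intro q hq hqp
    simp only [map_mul, map_prod, map_pow]
    rw [Finset.prod_eq_zero hq (h3 q hqp), zero_mul]

/-- Two plane projective curves without a common component have finitely many common points. -/
theorem finite_common_zeros {G H : MvPolynomial (Fin 3) ℂ} {a b : ℕ} (hG : G.IsHomogeneous a)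
    (hH : H.IsHomogeneous b) (hG0 : G ≠ 0) (hH0 : H ≠ 0) (hrel : IsRelPrime G H) :
    {p : CP2 | eval p.rep G = 0 ∧ eval p.rep H = 0}.Finite := by
  classical
  by_contra hinf
  -- Weak Bézout by dimension count. Vanishing on `s` has codimension `a * b + 1` in degree `N`. All
  -- multiples of `G` or `H` vanish there, and since a common multiple of `G` and `H` is a multiple
  -- of `G * H`, they span a space of codimension at most `a * b`.
  obtain ⟨s, hs, hcard⟩ := Set.Infinite.exists_subset_card_eq hinf (a * b + 1)
  set N := a + b + s.card with hN
  let S := homogeneousSubmodule (Fin 3) ℂ N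
  let ev : S →ₗ[ℂ] (s → ℂ) := LinearMap.pi fun p =>
    (MvPolynomial.aeval (R := ℂ) (p.1.rep)).toLinearMap ∘ₗ S.subtype
  have hev : ∀ (g : S) (p : s), ev g p = eval p.1.rep g.1 := fun g p => by
    simp [ev, MvPolynomial.aeval_eq_eval]
  have hsurj : Function.Surjective ev := by
    rw [← LinearMap.range_eq_top, eq_top_iff, ← (Pi.basisFun ℂ s).span_eq, Submodule.span_le]
    rintro _ ⟨p, rfl⟩
    obtain ⟨g, hg, hgp, hgq⟩ := exists_homogeneous_separating s p.1 (N := N) (by omega)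
    refine ⟨(eval p.1.rep g)⁻¹ • ⟨g, hg⟩, ?_⟩
    ext q
    rw [map_smul, Pi.smul_apply, hev, Pi.basisFun_apply]
    by_cases hq : q = p
    · subst hq; simp [hgp]
    · rw [hgq q.1 q.2 (fun h => hq (Subtype.ext h)), Pi.single_eq_of_ne hq, smul_zero]
  have hrk := LinearMap.finrank_range_add_finrank_ker ev
  rw [LinearMap.range_eq_top.2 hsurj, finrank_top] at hrk
  simp only [Module.finrank_fintype_fun_eq_card, Fintype.card_coe] at hrk
  set A := multiples G (b + s.card)
  set B := multiples H (a + s.card)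
  have hAB : A ⊔ B ≤ (LinearMap.ker ev).map S.subtype := by
    refine sup_le ?_ ?_
    · intro x hx
      obtain ⟨g, hg, rfl⟩ := mem_multiples.1 hx
      refine ⟨⟨G * g, by simpa [S, hN, add_assoc] using hG.mul hg⟩, ?_, rfl⟩
      ext p
      rw [hev]
      simp [(hs p.2).1]
    · intro x hx
      obtain ⟨g, hg, rfl⟩ := mem_multiples.1 hx
      refine ⟨⟨H * g, by
        have := hH.mul hg
        rwa [show b + (a + s.card) = N by omega] at this⟩, ?_, rfl⟩
      ext p
      rw [hev]
      simp [(hs p.2).2]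
  have hinter : A ⊓ B ≤ multiples (G * H) s.card := by
    rintro x ⟨hxA, hxB⟩
    obtain ⟨g, hg, rfl⟩ := mem_multiples.1 hxA
    obtain ⟨h, -, hgh⟩ := mem_multiples.1 hxB
    have hdvd : H ∣ g := hrel.symm.dvd_of_dvd_mul_left ⟨h, hgh.symm⟩
    obtain ⟨k, hk, rfl⟩ := mem_multiples.1 (mem_multiples_of_dvd hH hg hdvd)
    exact mem_multiples.2 ⟨k, hk, by ring⟩
  have e1 := Submodule.finrank_mono hAB
  have e2 := Submodule.finrank_mono hinter
  have e3 := Submodule.finrank_sup_add_finrank_inf_eq A B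
  have e4 := finrank_multiples hG0 (b + s.card)
  have e5 := finrank_multiples hH0 (a + s.card)
  have e6 := finrank_multiples (mul_ne_zero hG0 hH0) s.card
  have e7 : Module.finrank ℂ ((LinearMap.ker ev).map S.subtype) =
      Module.finrank ℂ (LinearMap.ker ev) :=
    (Submodule.equivMapOfInjective _ S.injective_subtype _).finrank_eq.symm
  have f1 := finrank_homogeneousSubmodule N
  have f2 := finrank_homogeneousSubmodule (b + s.card)
  have f3 := finrank_homogeneousSubmodule (a + s.card)
  have f4 := finrank_homogeneousSubmodule s.card
  have hfin : 2 * (a * b) + ((b + s.card + 1) * (b + s.card + 2) +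
      (a + s.card + 1) * (a + s.card + 2)) =
      (N + 1) * (N + 2) + (s.card + 1) * (s.card + 2) := by rw [hN]; ring
  change _ = Module.finrank ℂ (homogeneousSubmodule (Fin 3) ℂ N) at hrk
  simp only [A, B] at *
  omega

/-- The linear form with coefficients `l`. -/
noncomputable def linearForm (l : Fin 3 → ℂ) : MvPolynomial (Fin 3) ℂ := ∑ i, C (l i) * X i

theorem linearForm_isHomogeneous (l : Fin 3 → ℂ) : (linearForm l).IsHomogeneous 1 :=
  IsHomogeneous.sum _ _ _ fun _ _ => isHomogeneous_C_mul_X _ _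

theorem eval_linearForm (l x : Fin 3 → ℂ) : eval x (linearForm l) = ∑ i, l i * x i := by
  simp [linearForm]

/-- A polynomial that vanishes on the plane `l = 0` is divisible by `l`. -/
theorem linearForm_dvd {l : Fin 3 → ℂ} (hl : l ≠ 0) {G : MvPolynomial (Fin 3) ℂ}
    (h : ∀ x, eval x (linearForm l) = 0 → eval x G = 0) : linearForm l ∣ G := by
  obtain ⟨m, hm⟩ := Function.ne_iff.1 hl
  have hm : l m ≠ 0 := hm
  -- Substitution of a linear projection onto the plane `l = 0`: it kills `G`, yet it is the
  -- identity modulo `l`.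
  let π : MvPolynomial (Fin 3) ℂ →ₐ[ℂ] MvPolynomial (Fin 3) ℂ :=
    aeval fun i => X i - C ((Pi.single m (l m)⁻¹ : Fin 3 → ℂ) i) * linearForm l
  have hπ : π G = 0 := by
    refine MvPolynomial.funext fun x => ?_
    rw [map_zero]
    have : eval x (π G) = eval (fun i => x i - (Pi.single m (l m)⁻¹ : Fin 3 → ℂ) i *
        eval x (linearForm l)) G := by
      have hcomp : (aeval (R := ℂ) x).comp π = aeval (R := ℂ) (fun i => x i -
          (Pi.single m (l m)⁻¹ : Fin 3 → ℂ) i * eval x (linearForm l)) := by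
        ext i
        simp only [π, AlgHom.comp_apply, aeval_X, aeval_eq_eval, map_sub, map_mul, eval_C]
      have := congrArg (fun φ => φ G) hcomp
      simpa only [AlgHom.comp_apply, aeval_eq_eval] using this
    rw [this]
    apply h
    rw [eval_linearForm]
    simp only [mul_sub, Finset.sum_sub_distrib]
    rw [← eval_linearForm, sub_eq_zero]
    rw [Finset.sum_eq_single m]
    · simp [hm]
    · intro i _ hi; simp [hi]
    · simp
  have hquot : Ideal.Quotient.mk (Ideal.span {linearForm l}) (π G) =
      Ideal.Quotient.mk (Ideal.span {linearForm l}) G := by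
    have : (Ideal.Quotient.mkₐ ℂ (Ideal.span {linearForm l})).comp π =
        Ideal.Quotient.mkₐ ℂ (Ideal.span {linearForm l}) := by
      ext i
      simp only [π, AlgHom.comp_apply, aeval_X, map_sub, map_mul]
      have : Ideal.Quotient.mkₐ ℂ (Ideal.span {linearForm l}) (linearForm l) = 0 :=
        Ideal.Quotient.eq_zero_iff_mem.2 (Ideal.mem_span_singleton_self _)
      rw [this, mul_zero, sub_zero]
    exact congrArg (fun φ => φ G) this
  rw [hπ, map_zero, eq_comm, Ideal.Quotient.eq_zero_iff_mem, Ideal.mem_span_singleton] at hquot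
  exact hquot

/-- The restriction `t ↦ G (x + t y)` of a polynomial to an affine line. -/
noncomputable def restrictLine (x y : Fin 3 → ℂ) (G : MvPolynomial (Fin 3) ℂ) : Polynomial ℂ :=
  aeval (fun i => Polynomial.C (x i) + Polynomial.C (y i) * Polynomial.X) G

theorem eval_restrictLine (x y : Fin 3 → ℂ) (G : MvPolynomial (Fin 3) ℂ) (t : ℂ) :
    (restrictLine x y G).eval t = eval (x + t • y) G := by
  have : (Polynomial.aeval t).comp (aeval (R := ℂ) (fun i : Fin 3 =>
      Polynomial.C (x i) + Polynomial.C (y i) * Polynomial.X)) =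
      aeval (R := ℂ) (x + t • y) := by
    ext i
    simp only [AlgHom.comp_apply, aeval_X, map_add, map_mul, Polynomial.aeval_C,
      Polynomial.aeval_X, Pi.add_apply, Pi.smul_apply, smul_eq_mul, Algebra.algebraMap_self_apply]
    ring
  have := congrArg (fun φ => φ G) this
  simpa [restrictLine, aeval_eq_eval] using this

theorem natDegree_restrictLine_le (x y : Fin 3 → ℂ) {G : MvPolynomial (Fin 3) ℂ} {N : ℕ}
    (hG : G.IsHomogeneous N) : (restrictLine x y G).natDegree ≤ N := by
  have := MvPolynomial.aeval_natDegree_le G hG.totalDegree_le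
    (fun i => Polynomial.C (x i) + Polynomial.C (y i) * Polynomial.X) (n := 1) fun i => by
      compute_degree
  simpa [restrictLine] using this

/-- `G(y)` is the coefficient of `t ^ N` in the restriction. It is read off as the value at `s = 0`
of the reversed restriction, using `G(y + s x) = s ^ N G(x + s⁻¹ y)`. -/
theorem restrictLine_ne_zero {x y : Fin 3 → ℂ} {G : MvPolynomial (Fin 3) ℂ} {N : ℕ}
    (hG : G.IsHomogeneous N) (hy : eval y G ≠ 0) : restrictLine x y G ≠ 0 := by
  intro h
  apply hy
  have h1 : ∀ s : ℂ, s ≠ 0 → eval (y + s • x) G = 0 := by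
    intro s hs
    have h2 := eval_restrictLine x y G s⁻¹
    rw [h, Polynomial.eval_zero] at h2
    have h3 := hG.eval_smul s (x + s⁻¹ • y)
    rw [← h2, mul_zero, smul_add, smul_smul, mul_inv_cancel₀ hs, one_smul, add_comm] at h3
    exact h3
  have h4 : restrictLine y x G = 0 := by
    refine Polynomial.eq_zero_of_infinite_isRoot _ (Set.Infinite.mono (s := {0}ᶜ) ?_ ?_)
    · intro s hs
      change Polynomial.eval s _ = 0
      rw [eval_restrictLine]
      exact h1 s hs
    · exact (Set.finite_singleton (0 : ℂ)).infinite_compl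
  simpa [h4] using (eval_restrictLine y x G 0).symm

end HomogeneousPolynomials

/-! ### Homogeneity of the form and the Euler relation -/

namespace PolynomialFoliation

theorem homogenizeTo_isHomogeneous (n : ℕ) (p : MvPolynomial (Fin 2) ℂ) :
    (homogenizeTo n p).IsHomogeneous n := by
  refine IsHomogeneous.sum _ _ _ fun i hi => ?_
  have h1 : ((X 2 : MvPolynomial (Fin 3) ℂ) ^ (n - i)).IsHomogeneous (n - i) :=
    isHomogeneous_X_pow _ _
  have h2 : (rename (R := ℂ) (Fin.castSucc : Fin 2 → Fin 3)
      (homogeneousComponent i p)).IsHomogeneous i :=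
    (homogeneousComponent_isHomogeneous i p).rename_isHomogeneous
  have := h1.mul h2
  rwa [Nat.sub_add_cancel (by simpa [Nat.lt_succ_iff] using hi)] at this

theorem infinityPoly_isHomogeneous (F : PolynomialFoliation) :
    F.infinityPoly.IsHomogeneous (F.degree + 1) := by
  rw [add_comm]
  exact ((isHomogeneous_X _ _).mul (homogenizeTo_isHomogeneous _ _)).sub
    ((isHomogeneous_X _ _).mul (homogenizeTo_isHomogeneous _ _))

/-- The common degree is `F.degree` or `F.degree + 1`, according to whether the form was divided by
`Z`; later arguments need only its existence. -/
theorem exists_form_isHomogeneous (F : PolynomialFoliation) :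
    ∃ e, ∀ i, (F.form i).IsHomogeneous e := by
  unfold form
  split_ifs with h
  · refine ⟨F.degree, fun i => ?_⟩
    have hc : h.choose.IsHomogeneous F.degree := by
      have hs := h.choose_spec
      have hi := F.infinityPoly_isHomogeneous
      rw [hs] at hi
      by_cases h0 : (X 2 : MvPolynomial (Fin 3) ℂ) * h.choose = 0
      · rw [(mul_eq_zero.1 h0).resolve_left (X_ne_zero _)]
        exact isHomogeneous_zero _ _ _
      · obtain ⟨k, l, hkl, hk, hl⟩ := hi.exists_of_mul h0
        have := hk.inj_right (isHomogeneous_X _ _) (X_ne_zero _)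
        rwa [show l = F.degree by omega] at hl
    fin_cases i
    · exact homogenizeTo_isHomogeneous _ _
    · exact (homogenizeTo_isHomogeneous _ _).neg
    · exact hc
  · refine ⟨1 + F.degree, fun i => ?_⟩
    fin_cases i
    · exact (isHomogeneous_X _ _).mul (homogenizeTo_isHomogeneous _ _)
    · exact ((isHomogeneous_X _ _).mul (homogenizeTo_isHomogeneous _ _)).neg
    · simpa [add_comm] using F.infinityPoly_isHomogeneous

/-- The form kills the radial vector field, so that tangency to it is a condition on curves in the
projective plane. -/
theorem sum_X_mul_form (F : PolynomialFoliation) : ∑ i, X i * F.form i = 0 := by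
  unfold form
  split_ifs with h
  · have hs := h.choose_spec
    simp only [Fin.sum_univ_three, Matrix.cons_val]
    rw [← hs, infinityPoly]
    ring
  · simp only [Fin.sum_univ_three, Matrix.cons_val]
    rw [infinityPoly]
    ring

end PolynomialFoliation

theorem analyticAt_eval (p : MvPolynomial (Fin 3) ℂ) (x : Fin 3 → ℂ) :
    AnalyticAt ℂ (fun x => eval x p) x :=
  AnalyticOnNhd.eval_mvPolynomial p x (Set.mem_univ _)

theorem continuous_eval_vec (p : MvPolynomial (Fin 3) ℂ) : Continuous fun x => eval x p :=
  continuous_iff_continuousAt.2 fun x => (analyticAt_eval p x).continuousAt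

/-! ### Affine charts given by a frame -/

section Frames

variable {p q e : Fin 3 → ℂ}

theorem linearIndependent_triple_iff :
    LinearIndependent ℂ ![p, q, e] ↔
      ∀ a b c : ℂ, a • p + b • q + c • e = 0 → a = 0 ∧ b = 0 ∧ c = 0 := by
  rw [Fintype.linearIndependent_iff]
  constructor
  · intro h a b c habc
    have := h ![a, b, c] (by simpa [Fin.sum_univ_three] using habc)
    exact ⟨this 0, this 1, this 2⟩
  · intro h g hg
    have := h (g 0) (g 1) (g 2) (by simpa [Fin.sum_univ_three] using hg)
    intro i
    fin_cases i
    exacts [this.1, this.2.1, this.2.2]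

theorem add_smul_add_smul_ne_zero (h : LinearIndependent ℂ ![p, q, e]) (u v : ℂ) :
    p + u • q + v • e ≠ 0 := by
  intro h0
  have := linearIndependent_triple_iff.1 h 1 u v (by simpa using h0)
  exact one_ne_zero this.1

open Filter Topology in
/-- Near `p` every vector is a multiple of `p + u q + v e`, with coordinates that depend
continuously on it. -/
theorem exists_projective_coordinates (h : LinearIndependent ℂ ![p, q, e]) :
    ∃ c u v : (Fin 3 → ℂ) → ℂ, Tendsto c (𝓝 p) (𝓝 1) ∧ Tendsto u (𝓝 p) (𝓝 0) ∧
      Tendsto v (𝓝 p) (𝓝 0) ∧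
      ∀ᶠ x in 𝓝 p, c x ≠ 0 ∧ x = c x • (p + u x • q + v x • e) := by
  let b := basisOfLinearIndependentOfCardEqFinrank h (by simp)
  have hb : ⇑b = ![p, q, e] := coe_basisOfLinearIndependentOfCardEqFinrank h _
  have hc : ∀ i, Continuous fun x => b.repr x i := fun i =>
    ((b.coord i).continuous_of_finiteDimensional :)
  have hp : b.repr p = Finsupp.single 0 1 := by
    have : p = b 0 := by rw [hb]; rfl
    rw [this, b.repr_self]
  have h0 : Tendsto (fun x => b.repr x 0) (𝓝 p) (𝓝 1) := by
    have := (hc 0).tendsto p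
    rwa [hp, Finsupp.single_eq_same] at this
  have h1 : Tendsto (fun x => b.repr x 1) (𝓝 p) (𝓝 0) := by
    have := (hc 1).tendsto p
    rwa [hp, Finsupp.single_eq_of_ne (by decide)] at this
  have h2 : Tendsto (fun x => b.repr x 2) (𝓝 p) (𝓝 0) := by
    have := (hc 2).tendsto p
    rwa [hp, Finsupp.single_eq_of_ne (by decide)] at this
  refine ⟨fun x => b.repr x 0, fun x => b.repr x 1 / b.repr x 0, fun x => b.repr x 2 / b.repr x 0,
    h0, by have := h1.div h0 one_ne_zero; rw [zero_div] at this; exact this,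
    by have := h2.div h0 one_ne_zero; rw [zero_div] at this; exact this, ?_⟩
  filter_upwards [h0.eventually_ne one_ne_zero] with x hx
  refine ⟨hx, ?_⟩
  have := b.sum_repr x
  rw [hb, Fin.sum_univ_three] at this
  simp only [smul_add, smul_smul, mul_div_cancel₀ _ hx]
  exact this.symm

end Frames

/-! ### Plaques and saturated sets -/

namespace PolynomialFoliation

/-- The value of the form of the foliation at the point `x` on the vector `w`. -/
noncomputable def formAt (F : PolynomialFoliation) (x w : Fin 3 → ℂ) : ℂ :=
  ∑ i, eval x (F.form i) * w i

theorem formAt_add (F : PolynomialFoliation) (x v w : Fin 3 → ℂ) :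
    F.formAt x (v + w) = F.formAt x v + F.formAt x w := by
  simp [formAt, mul_add, Finset.sum_add_distrib]

theorem formAt_smul (F : PolynomialFoliation) (c : ℂ) (x w : Fin 3 → ℂ) :
    F.formAt x (c • w) = c * F.formAt x w := by
  simp only [formAt, Pi.smul_apply, smul_eq_mul, Finset.mul_sum]
  exact Finset.sum_congr rfl fun i _ => by ring

theorem formAt_self (F : PolynomialFoliation) (x : Fin 3 → ℂ) : F.formAt x x = 0 := by
  have := congrArg (eval x) F.sum_X_mul_form
  simpa [formAt, mul_comm] using this

theorem analyticAt_formAt (F : PolynomialFoliation) (x w : Fin 3 → ℂ) :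
    AnalyticAt ℂ (fun x => F.formAt x w) x :=
  Finset.analyticAt_fun_sum _ fun i _ => (analyticAt_eval (F.form i) x).mul analyticAt_const

/-- A set of nonzero vectors in `ℂ³` that is the cone over a union of leaves. -/
structure IsSaturated (F : PolynomialFoliation) (Λ : Set (Fin 3 → ℂ)) : Prop where
  ne_zero : ∀ x ∈ Λ, x ≠ 0
  smul_mem : ∀ x ∈ Λ, ∀ c : ℂ, c ≠ 0 → c • x ∈ Λ
  regular : ∀ x ∈ Λ, ∃ i, eval x (F.form i) ≠ 0
  disc : ∀ γ, F.IsTangentDisc γ → ∀ s ∈ Metric.ball (0 : ℂ) 1, ∀ t ∈ Metric.ball (0 : ℂ) 1,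
    γ s ∈ Λ → γ t ∈ Λ

/-- The curve `u ↦ p + u q + f(u) e`, defined for `‖u‖ < r`, is tangent to the foliation and
transverse to the direction `e`. -/
def IsPlaque (F : PolynomialFoliation) (p q e : Fin 3 → ℂ) (r ρ : ℝ) (f : ℂ → ℂ) : Prop :=
  ∀ u, ‖u‖ < r → ‖f u‖ < ρ ∧ F.formAt (p + u • q + f u • e) e ≠ 0 ∧
    HasDerivAt f (-F.formAt (p + u • q + f u • e) q / F.formAt (p + u • q + f u • e) e) u

variable {F : PolynomialFoliation} {p q e : Fin 3 → ℂ} {r ρ : ℝ} {f : ℂ → ℂ}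
  {Λ : Set (Fin 3 → ℂ)}

/-- In the chart `p + u q + v e` tangency reads `ω(q) + v' ω(e) = 0`, a scalar equation for `v(u)`
because `ω(e) ≠ 0` near `p`. The essential gain is a radius `r` common to all plaques through points
near `p`. -/
theorem exists_plaques (he : F.formAt p e ≠ 0) (q : Fin 3 → ℂ) :
    ∃ r > 0, ∃ ρ : ℝ,
      (∃ δ > 0, δ ≤ r ∧ ∀ u₀ v₀ : ℂ, ‖u₀‖ < δ → ‖v₀‖ < δ →
        ∃ f : ℂ → ℂ, f u₀ = v₀ ∧ F.IsPlaque p q e r ρ f) ∧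
      ∀ f g : ℂ → ℂ, F.IsPlaque p q e r ρ f → F.IsPlaque p q e r ρ g →
        ∀ u₀ u, ‖u₀‖ < r → ‖u‖ < r → ‖f u - g u‖ ≤ 2 * ‖f u₀ - g u₀‖ := by
  have hpt : AnalyticAt ℂ (fun z : ℂ × ℂ => p + z.1 • q + z.2 • e) 0 :=
    (analyticAt_const.add (analyticAt_fst.smul analyticAt_const)).add
      (analyticAt_snd.smul analyticAt_const)
  have hform : ∀ w, AnalyticAt ℂ (fun z : ℂ × ℂ => F.formAt (p + z.1 • q + z.2 • e) w) 0 :=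
    fun w => (F.analyticAt_formAt _ w).comp hpt
  have h0 : F.formAt (p + (0 : ℂ × ℂ).1 • q + (0 : ℂ × ℂ).2 • e) e ≠ 0 := by simpa using he
  obtain ⟨r, hr, ρ, -, hS, ⟨δ, hδ, hδr, hex⟩, hun⟩ := exists_holomorphic_solutions
    ((hform q).neg.div (hform e) h0) ((hform e).continuousAt.eventually_ne h0)
  refine ⟨r, hr, ρ, ⟨δ, hδ, hδr, fun u₀ v₀ hu hv => ?_⟩, fun f g hf hg => ?_⟩
  · obtain ⟨f, hf0, hf⟩ := hex u₀ v₀ hu hv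
    exact ⟨f, hf0, fun u hu => ⟨(hf u hu).1, hS u _ hu (hf u hu).1, (hf u hu).2⟩⟩
  · exact hun f g (fun u hu => ⟨(hf u hu).1, (hf u hu).2.2⟩)
      fun u hu => ⟨(hg u hu).1, (hg u hu).2.2⟩

theorem IsPlaque.differentiableOn (hf : F.IsPlaque p q e r ρ f) :
    DifferentiableOn ℂ f (Metric.ball 0 r) := fun u hu =>
  (hf u (by simpa using hu)).2.2.differentiableAt.differentiableWithinAt

theorem IsPlaque.analyticAt (hf : F.IsPlaque p q e r ρ f) (hr : 0 < r) : AnalyticAt ℂ f 0 :=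
  hf.differentiableOn.analyticAt (Metric.ball_mem_nhds _ hr)

theorem IsPlaque.isTangentDisc (hli : LinearIndependent ℂ ![p, q, e]) (hr : 0 < r)
    (hf : F.IsPlaque p q e r ρ f) :
    F.IsTangentDisc fun t => p + ((r : ℂ) * t) • q + f (r * t) • e := by
  have hball : ∀ t ∈ Metric.ball (0 : ℂ) 1, ‖(r : ℂ) * t‖ < r := by
    intro t ht
    have ht : ‖t‖ < 1 := by simpa using ht
    rw [norm_mul, Complex.norm_real, Real.norm_of_nonneg hr.le]
    nlinarith
  have hder : ∀ t ∈ Metric.ball (0 : ℂ) 1,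
      HasDerivAt (fun t : ℂ => p + ((r : ℂ) * t) • q + f (r * t) • e)
        ((r : ℂ) • q + (-F.formAt (p + ((r : ℂ) * t) • q + f (r * t) • e) q /
          F.formAt (p + ((r : ℂ) * t) • q + f (r * t) • e) e * r) • e) t := by
    intro t ht
    have h1 : HasDerivAt (fun t : ℂ => (r : ℂ) * t) r t := by
      simpa using (hasDerivAt_id t).const_mul (r : ℂ)
    have h2 := ((hf _ (hball t ht)).2.2.comp t h1).smul_const e
    exact ((h1.smul_const q).const_add p).add h2
  refine ⟨fun t ht => (hder t ht).differentiableAt.differentiableWithinAt,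
    fun t _ => add_smul_add_smul_ne_zero hli _ _, fun t ht => ?_, fun t ht => ?_⟩
  · by_contra! hc
    exact (hf _ (hball t ht)).2.1 (Finset.sum_eq_zero fun i _ => by rw [hc i, zero_mul])
  · rw [(hder t ht).deriv]
    change F.formAt _ _ = 0
    rw [formAt_add, formAt_smul, formAt_smul]
    have := (hf _ (hball t ht)).2.1
    field_simp
    ring

theorem IsSaturated.plaque_mem (hΛ : F.IsSaturated Λ) (hli : LinearIndependent ℂ ![p, q, e])
    (hf : F.IsPlaque p q e r ρ f) {u₀ u : ℂ} (hu₀ : ‖u₀‖ < r) (hu : ‖u‖ < r)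
    (h : p + u₀ • q + f u₀ • e ∈ Λ) : p + u • q + f u • e ∈ Λ := by
  have hr : 0 < r := (norm_nonneg _).trans_lt hu
  have hr' : (r : ℂ) ≠ 0 := by exact_mod_cast hr.ne'
  have hmem : ∀ w : ℂ, ‖w‖ < r → w / r ∈ Metric.ball (0 : ℂ) 1 := by
    intro w hw
    rw [mem_ball_zero_iff, norm_div, Complex.norm_real, Real.norm_of_nonneg hr.le, div_lt_one hr]
    exact hw
  have := hΛ.disc _ (hf.isTangentDisc hli hr) (u₀ / r) (hmem _ hu₀) (u / r) (hmem _ hu)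
  simp only [mul_div_cancel₀ _ hr'] at this
  exact this h

open Filter Topology in
/-- Near a point of `Λ` close to `p` there is a plaque contained in `Λ` close to the plaque
through `p`. -/
theorem IsSaturated.eventually_exists_plaque (hΛ : F.IsSaturated Λ)
    (hli : LinearIndependent ℂ ![p, q, e]) (he : F.formAt p e ≠ 0) :
    ∃ r > 0, ∃ ρ : ℝ, ∃ f, f 0 = 0 ∧ F.IsPlaque p q e r ρ f ∧
      ∃ c u : (Fin 3 → ℂ) → ℂ, Tendsto c (𝓝 p) (𝓝 1) ∧ Tendsto u (𝓝 p) (𝓝 0) ∧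
      ∀ ε > 0, ∀ᶠ x in 𝓝[Λ] p, c x ≠ 0 ∧ ‖u x‖ < r ∧
        ∃ g, F.IsPlaque p q e r ρ g ∧ x = c x • (p + u x • q + g (u x) • e) ∧
          (∀ w, ‖w‖ < r → p + w • q + g w • e ∈ Λ) ∧ (∀ w, ‖w‖ < r → ‖g w - f w‖ < ε) ∧
          (∀ w₀ w, ‖w₀‖ < r → ‖w‖ < r → ‖g w - f w‖ ≤ 2 * ‖g w₀ - f w₀‖) := by
  obtain ⟨r, hr, ρ, ⟨δ, hδ, hδr, hex⟩, hun⟩ := exists_plaques he q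
  obtain ⟨f, hf0, hf⟩ := hex 0 0 (by simpa) (by simpa)
  obtain ⟨c, u, v, hc, hu, hv, hx⟩ := exists_projective_coordinates hli
  refine ⟨r, hr, ρ, f, hf0, hf, c, u, hc, hu, fun ε hε => ?_⟩
  have hfu : Tendsto (fun x => v x - f (u x)) (𝓝 p) (𝓝 0) := by
    have h1 : Tendsto f (𝓝 0) (𝓝 0) := by
      have := (hf.analyticAt hr).continuousAt.tendsto
      rwa [hf0] at this
    simpa using hv.sub (h1.comp hu)
  have e1 : ∀ᶠ x in 𝓝 p, ‖u x‖ < δ := by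
    simpa using hu.eventually (Metric.ball_mem_nhds 0 hδ)
  have e2 : ∀ᶠ x in 𝓝 p, ‖v x‖ < δ := by
    simpa using hv.eventually (Metric.ball_mem_nhds 0 hδ)
  -- Half of `ε`, since the Lipschitz bound doubles the gap at `u x` when passing to an arbitrary
  -- `w`.
  have e3 : ∀ᶠ x in 𝓝 p, ‖v x - f (u x)‖ < ε / 2 := by
    simpa using hfu.eventually (Metric.ball_mem_nhds 0 (half_pos hε))
  filter_upwards [nhdsWithin_le_nhds e1, nhdsWithin_le_nhds e2, nhdsWithin_le_nhds e3,
    nhdsWithin_le_nhds hx, self_mem_nhdsWithin] with x h1 h2 h3 h4 h5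
  obtain ⟨g, hg0, hg⟩ := hex (u x) (v x) h1 h2
  have hur : ‖u x‖ < r := h1.trans_le hδr
  have hxg : x = c x • (p + u x • q + g (u x) • e) := by rw [hg0]; exact h4.2
  refine ⟨h4.1, hur, g, hg, hxg, fun w hw => ?_, fun w hw => ?_, fun w₀ w hw₀ hw =>
    hun g f hg hf w₀ w hw₀ hw⟩
  · refine hΛ.plaque_mem hli hg hur hw ?_
    have := hΛ.smul_mem x h5 (c x)⁻¹ (inv_ne_zero h4.1)
    rwa [hxg, smul_smul, ← hxg, inv_mul_cancel₀ h4.1, one_smul] at this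
  · have := hun g f hg hf (u x) w hur hw
    rw [hg0] at this
    linarith

open Filter Topology in
/-- The closure of a saturated set contains a plaque through each of its regular points. -/
theorem IsSaturated.exists_plaque_closure (hΛ : F.IsSaturated Λ)
    (hli : LinearIndependent ℂ ![p, q, e]) (he : F.formAt p e ≠ 0) (hp : p ∈ closure Λ) :
    ∃ r > 0, ∃ ρ : ℝ, ∃ f, f 0 = 0 ∧ F.IsPlaque p q e r ρ f ∧
      ∀ u, ‖u‖ < r → p + u • q + f u • e ∈ closure Λ := by
  obtain ⟨r, hr, ρ, f, hf0, hf, c, u, -, -, hev⟩ := hΛ.eventually_exists_plaque hli he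
  refine ⟨r, hr, ρ, f, hf0, hf, fun w hw => Metric.mem_closure_iff.2 fun ε hε => ?_⟩
  have : (𝓝[Λ] p).NeBot := mem_closure_iff_nhdsWithin_neBot.1 hp
  obtain ⟨x, -, -, g, -, -, hmem, hclose, -⟩ := (hev (ε / (‖e‖ + 1)) (by positivity)).exists
  refine ⟨_, hmem w hw, ?_⟩
  rw [dist_comm, dist_eq_norm, add_sub_add_left_eq_sub, ← sub_smul, norm_smul]
  have h1 := hclose w hw
  rw [lt_div_iff₀ (by positivity)] at h1
  nlinarith [norm_nonneg (g w - f w)]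

end PolynomialFoliation

/-! ### The maximum principle on the closure of a saturated set -/

namespace PolynomialFoliation

open scoped Matrix
open Filter Topology

variable {F : PolynomialFoliation} {p q e : Fin 3 → ℂ} {r ρ : ℝ} {f : ℂ → ℂ}
  {Λ : Set (Fin 3 → ℂ)} {l : Fin 3 → ℂ}

/-- A regular point is the first vector of a frame whose last vector is transverse to the
foliation. -/
theorem exists_frame {x : Fin 3 → ℂ} (hx : x ≠ 0) (hreg : ∃ i, eval x (F.form i) ≠ 0) :
    ∃ q e, LinearIndependent ℂ ![x, q, e] ∧ F.formAt x e ≠ 0 := by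
  obtain ⟨i, hi⟩ := hreg
  have he : F.formAt x (Pi.single i 1) ≠ 0 := by
    simpa [formAt, Pi.single_apply] using hi
  have h2 : LinearIndependent ℂ ![x, Pi.single i 1] := by
    rw [LinearIndependent.pair_iff]
    intro s t hst
    have h3 := congrArg (F.formAt x) hst
    rw [formAt_add, formAt_smul, formAt_smul, formAt_self, mul_zero, zero_add] at h3
    have h4 : t = 0 := by
      refine (mul_eq_zero.1 (h3.trans ?_)).resolve_right he
      simp [formAt]
    rw [h4, zero_smul, add_zero] at hst
    exact ⟨(smul_eq_zero.1 hst).resolve_right hx, h4⟩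
  obtain ⟨q, hq⟩ := exists_linearIndependent_snoc_of_lt_finrank h2 (by simp)
  refine ⟨q, Pi.single i 1, linearIndependent_triple_iff.2 fun a b c habc => ?_, he⟩
  rw [Fintype.linearIndependent_iff] at hq
  have := hq ![a, c, b] (by
    rw [← habc]
    simp [Fin.sum_univ_three, Fin.snoc]
    abel)
  exact ⟨this 0, this 2, this 1⟩

theorem IsSaturated.smul_mem_closure (hΛ : F.IsSaturated Λ) {x : Fin 3 → ℂ} (hx : x ∈ closure Λ)
    {c : ℂ} (hc : c ≠ 0) : c • x ∈ closure Λ :=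
  map_mem_closure (continuous_const_smul c) hx fun y hy => hΛ.smul_mem y hy c hc

theorem continuous_dotProduct_left (l : Fin 3 → ℂ) : Continuous fun x => l ⬝ᵥ x := by
  unfold dotProduct
  fun_prop

theorem analyticAt_dotProduct_left (l x : Fin 3 → ℂ) : AnalyticAt ℂ (fun x => l ⬝ᵥ x) x := by
  simp only [← eval_linearForm, dotProduct]
  exact analyticAt_eval _ _

/-- The functions `G aᵢ Xⱼ / l ^ k` on the affine chart `l ≠ 0`. -/
noncomputable def testMap (F : PolynomialFoliation) (G : MvPolynomial (Fin 3) ℂ) (l : Fin 3 → ℂ)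
    (k : ℕ) (x : Fin 3 → ℂ) : EuclideanSpace ℂ (Fin 3 × Fin 3) :=
  WithLp.toLp 2 fun ij => eval x G / (l ⬝ᵥ x) ^ k * (eval x (F.form ij.1) * x ij.2)

theorem testMap_smul {d N : ℕ} (hd : ∀ i, (F.form i).IsHomogeneous d)
    {G : MvPolynomial (Fin 3) ℂ} (hG : G.IsHomogeneous N) (l x : Fin 3 → ℂ) {c : ℂ} (hc : c ≠ 0) :
    F.testMap G l (N + d + 1) (c • x) = F.testMap G l (N + d + 1) x := by
  unfold testMap
  congr 1
  ext ij
  rw [hG.eval_smul, (hd _).eval_smul, dotProduct_smul, smul_eq_mul, Pi.smul_apply, smul_eq_mul,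
    mul_pow]
  by_cases h : l ⬝ᵥ x = 0
  · simp [h]
  · field_simp
    ring

theorem analyticAt_testMap (G : MvPolynomial (Fin 3) ℂ) (k : ℕ) {x : Fin 3 → ℂ}
    (hx : l ⬝ᵥ x ≠ 0) : AnalyticAt ℂ (F.testMap G l k) x := by
  have h : AnalyticAt ℂ (fun x (ij : Fin 3 × Fin 3) =>
      eval x G / (l ⬝ᵥ x) ^ k * (eval x (F.form ij.1) * x ij.2)) x := by
    refine AnalyticAt.pi fun ij => ?_
    exact ((analyticAt_eval G x).div ((analyticAt_dotProduct_left l x).pow k)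
      (pow_ne_zero _ hx)).mul ((analyticAt_eval _ x).mul
        ((ContinuousLinearMap.proj (R := ℂ) (φ := fun _ : Fin 3 => ℂ) ij.2).analyticAt x))
  exact ((PiLp.continuousLinearEquiv 2 ℂ
    (fun _ : Fin 3 × Fin 3 => ℂ)).symm.toContinuousLinearMap.analyticAt _).comp h

/-- **Maximum principle.** If `G / l ^ (deg G + d + 1)` tends to zero along a saturated set at the
points of the line `l = 0`, then `G` vanishes on this set off the line. -/
theorem IsSaturated.eval_eq_zero_of_tendsto (hΛ : F.IsSaturated Λ) {d N : ℕ}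
    (hd : ∀ i, (F.form i).IsHomogeneous d) {G : MvPolynomial (Fin 3) ℂ} (hG : G.IsHomogeneous N)
    (hlim : ∀ p ∈ closure Λ, p ≠ 0 → l ⬝ᵥ p = 0 →
      Tendsto (fun x => eval x G / (l ⬝ᵥ x) ^ (N + d + 1)) (𝓝[Λ] p) (𝓝 0))
    {y : Fin 3 → ℂ} (hy : y ∈ Λ) (hly : l ⬝ᵥ y ≠ 0) : eval y G = 0 := by
  set k := N + d + 1 with hk
  -- The exponent `k` makes `Ψ` homogeneous of degree zero. The factors `ωᵢ` make it vanish at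
  -- singular points, so a nonzero maximum is attained at a regular point; the factors `Xⱼ` prevent
  -- it from being constant along a plaque.
  set Ψ := F.testMap G l k with hΨ
  -- Division by zero gives the value 0 on the line, which is the continuous extension.
  have hΨ0 : ∀ x, l ⬝ᵥ x = 0 → Ψ x = 0 := by
    intro x hx
    ext ij
    simp [hΨ, testMap, hx, hk]
  have hcont : ContinuousOn (fun x => ‖Ψ x‖) (closure Λ ∩ Metric.sphere 0 1) := by
    rintro x ⟨hx, hx1⟩
    have hx0 : x ≠ 0 := by rintro rfl; simp at hx1
    refine ContinuousWithinAt.mono ?_ Set.inter_subset_left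
    by_cases hl : l ⬝ᵥ x = 0
    · have h1 : Tendsto Ψ (𝓝[Λ] x) (𝓝 0) := by
        have h2 : Tendsto (fun x (ij : Fin 3 × Fin 3) =>
            eval x G / (l ⬝ᵥ x) ^ k * (eval x (F.form ij.1) * x ij.2)) (𝓝[Λ] x) (𝓝 0) := by
          refine tendsto_pi_nhds.2 fun ij => ?_
          have h3 : Tendsto (fun x : Fin 3 → ℂ => eval x (F.form ij.1) * x ij.2) (𝓝[Λ] x)
              (𝓝 (eval x (F.form ij.1) * x ij.2)) :=
            (((continuous_eval_vec _).mul (continuous_apply _)).tendsto x).mono_left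
              nhdsWithin_le_nhds
          simpa using (hlim x hx hx0 hl).mul h3
        exact ((PiLp.continuousLinearEquiv 2 ℂ (fun _ : Fin 3 × Fin 3 => ℂ)).symm.continuous.tendsto
          0).comp h2
      rw [ContinuousWithinAt, hΨ0 x hl, norm_zero, Metric.tendsto_nhds]
      intro ε hε
      have h2 : ∀ᶠ z in 𝓝[Λ] x, ‖Ψ z‖ < ε / 2 := by
        simpa using h1.eventually (Metric.ball_mem_nhds 0 (half_pos hε))
      obtain ⟨U, hU, hxU, hUsub⟩ := mem_nhdsWithin.1 h2
      refine mem_nhdsWithin.2 ⟨U, hU, hxU, ?_⟩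
      rintro z ⟨hzU, hz⟩
      change dist ‖Ψ z‖ 0 < ε
      rw [dist_zero_right, norm_norm]
      -- The hypothesis controls `Ψ` only along `Λ`. A nearby point of the closure is either on the
      -- line, where `Ψ` is zero, or a point of continuity, where the bound passes to the limit.
      by_cases hlz : l ⬝ᵥ z = 0
      · rw [hΨ0 z hlz, norm_zero]; exact hε
      · have hzc : z ∈ closure (Λ ∩ U) := by
          rw [Set.inter_comm]; exact hU.inter_closure ⟨hzU, hz⟩
        have : (𝓝[Λ ∩ U] z).NeBot := mem_closure_iff_nhdsWithin_neBot.1 hzc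
        have h3 : Tendsto (fun z => ‖Ψ z‖) (𝓝[Λ ∩ U] z) (𝓝 ‖Ψ z‖) :=
          ((analyticAt_testMap G k hlz).continuousAt.norm.tendsto).mono_left nhdsWithin_le_nhds
        have h4 : ‖Ψ z‖ ≤ ε / 2 := le_of_tendsto h3 (by
          filter_upwards [self_mem_nhdsWithin] with w hw
          exact le_of_lt (hUsub ⟨hw.2, hw.1⟩))
        linarith
    · exact (analyticAt_testMap G k hl).continuousAt.norm.continuousWithinAt
  have hunit : ∀ x : Fin 3 → ℂ, x ≠ 0 → ((‖x‖⁻¹ : ℝ) : ℂ) ≠ 0 ∧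
      ((‖x‖⁻¹ : ℝ) : ℂ) • x ∈ Metric.sphere (0 : Fin 3 → ℂ) 1 := by
    intro x hx
    have := norm_ne_zero_iff.2 hx
    refine ⟨by exact_mod_cast inv_ne_zero this, ?_⟩
    rw [mem_sphere_zero_iff_norm, norm_smul, Complex.norm_real, norm_inv, norm_norm,
      inv_mul_cancel₀ this]
  have hy0 := hΛ.ne_zero y hy
  have hK : IsCompact (closure Λ ∩ Metric.sphere (0 : Fin 3 → ℂ) 1) :=
    (isCompact_sphere _ _).inter_left isClosed_closure
  obtain ⟨x, ⟨hx, hx1⟩, hmax⟩ := hK.exists_isMaxOn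
    ⟨_, hΛ.smul_mem_closure (subset_closure hy) (hunit y hy0).1, (hunit y hy0).2⟩ hcont
  have hmax : ∀ z ∈ closure Λ, z ≠ 0 → ‖Ψ z‖ ≤ ‖Ψ x‖ := by
    intro z hz hz0
    have := hmax ⟨hΛ.smul_mem_closure hz (hunit z hz0).1, (hunit z hz0).2⟩
    change ‖Ψ _‖ ≤ ‖Ψ x‖ at this
    rwa [hΨ, testMap_smul hd hG l z (hunit z hz0).1] at this
  have hx0 : x ≠ 0 := by rintro rfl; simp at hx1
  by_contra hGy
  have hΨy : Ψ y ≠ 0 := by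
    obtain ⟨i, hi⟩ := hΛ.regular y hy
    obtain ⟨j, hj⟩ := Function.ne_iff.1 hy0
    intro h0
    have := congrArg (fun z => z (i, j)) h0
    simp only [hΨ, testMap, PiLp.zero_apply] at this
    exact mul_ne_zero (div_ne_zero hGy (pow_ne_zero _ hly)) (mul_ne_zero hi hj) this
  have hΨx : Ψ x ≠ 0 := fun h0 => by
    have := hmax y (subset_closure hy) hy0
    rw [h0, norm_zero, norm_le_zero_iff] at this
    exact hΨy this
  have hlx : l ⬝ᵥ x ≠ 0 := fun h => hΨx (hΨ0 x h)
  obtain ⟨⟨i, j⟩, hij⟩ : ∃ ij, Ψ x ij ≠ 0 := by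
    by_contra! h
    exact hΨx (by ext ij; exact h ij)
  have hix : eval x (F.form i) ≠ 0 := by
    intro h; apply hij; simp [hΨ, testMap, h]
  have hGx : eval x G ≠ 0 := by
    intro h; apply hij; simp [hΨ, testMap, h]
  obtain ⟨q, e, hli, he⟩ := exists_frame hx0 ⟨i, hix⟩
  obtain ⟨r, hr, ρ, f, hf0, hf, hcl⟩ := hΛ.exists_plaque_closure hli he hx
  set φ : ℂ → Fin 3 → ℂ := fun u => x + u • q + f u • e with hφ
  have hφ0 : φ 0 = x := by simp [hφ, hf0]
  have hφd : ∀ u ∈ Metric.ball (0 : ℂ) r, DifferentiableAt ℂ φ u := by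
    intro u hu
    have := (hf u (by simpa using hu)).2.2.differentiableAt
    fun_prop
  have hball := Metric.ball_mem_nhds (0 : ℂ) hr
  have hlφ : ∀ᶠ u in 𝓝 (0 : ℂ), l ⬝ᵥ φ u ≠ 0 := by
    have h1 : ContinuousAt (fun u => l ⬝ᵥ φ u) 0 :=
      (continuous_dotProduct_left l).continuousAt.comp
        (hφd 0 (Metric.mem_ball_self hr)).continuousAt
    exact h1.eventually_ne (by rw [hφ0]; exact hlx)
  -- The Euclidean norm is strictly convex, so at a local maximum of the norm the vector `Ψ` itself
  -- is locally constant.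
  have hconst : ∀ᶠ u in 𝓝 (0 : ℂ), Ψ (φ u) = Ψ (φ 0) := by
    refine Complex.eventually_eq_of_isLocalMax_norm (f := fun u => Ψ (φ u)) ?_ ?_
    · filter_upwards [hball, hlφ] with u hu hlu
      exact (analyticAt_testMap G k hlu).differentiableAt.comp u (hφd u hu)
    · filter_upwards [hball] with u hu
      simp only [Function.comp, hφ0]
      exact hmax _ (hcl u (by simpa using hu)) (add_smul_add_smul_ne_zero hli _ _)
  obtain ⟨u, hu, hu0⟩ := (hconst.filter_mono nhdsWithin_le_nhds |>.and
    (self_mem_nhdsWithin (s := {(0 : ℂ)}ᶜ))).exists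
  have hu0 : u ≠ 0 := hu0
  rw [hφ0] at hu
  -- The `i`-th row of `Ψ (φ u) = Ψ x` reads `A φ(u) = B x` with `B ≠ 0`; but `φ u` and `x` are not
  -- proportional for `u ≠ 0`.
  set A := eval (φ u) G / (l ⬝ᵥ φ u) ^ k * eval (φ u) (F.form i)
  set B := eval x G / (l ⬝ᵥ x) ^ k * eval x (F.form i) with hB
  have hB0 : B ≠ 0 := mul_ne_zero (div_ne_zero hGx (pow_ne_zero _ hlx)) hix
  have hAB : A • φ u = B • x := by
    ext m
    have := congrArg (fun z => z (i, m)) hu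
    simpa only [hΨ, testMap, Pi.smul_apply, smul_eq_mul, ← mul_assoc] using this
  have hlin := linearIndependent_triple_iff.1 hli (A - B) (A * u) (A * f u) (by
    have : A • (x + u • q + f u • e) - B • x = 0 := sub_eq_zero.2 hAB
    rw [← this]
    module)
  have hA : A = 0 := (mul_eq_zero.1 hlin.2.1).resolve_right hu0
  exact hB0 (by rw [← sub_eq_zero.1 hlin.1, hA])

/-! ### Saturated sets near a line without singular points -/

/-- A homogeneous polynomial of positive degree vanishes somewhere on every projective line. -/
theorem exists_zero_on_line {h : MvPolynomial (Fin 3) ℂ} {d : ℕ} (hh : h.IsHomogeneous d)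
    (hd : d ≠ 0) (p q : Fin 3 → ℂ) : eval q h = 0 ∨ ∃ t : ℂ, eval (p + t • q) h = 0 := by
  -- Degree 0 means a nonzero constant, in which case all zeros sit at the point at infinity `q`.
  -- The zero polynomial has degree `⊥` and falls into the second case.
  by_cases hdeg : (restrictLine p q h).degree = 0
  · left
    by_contra hq
    obtain ⟨c, hc⟩ : ∃ c, restrictLine p q h = Polynomial.C c :=
      ⟨_, Polynomial.eq_C_of_degree_eq_zero hdeg⟩
    have h1 : restrictLine q p h = Polynomial.C c * Polynomial.X ^ d := by
      refine Polynomial.eq_of_infinite_eval_eq _ _ (Set.Infinite.mono (s := {0}ᶜ) ?_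
        (Set.finite_singleton (0 : ℂ)).infinite_compl)
      intro s hs
      have hs : s ≠ 0 := hs
      change Polynomial.eval s _ = Polynomial.eval s _
      have h2 := eval_restrictLine p q h s⁻¹
      have h3 := hh.eval_smul s (p + s⁻¹ • q)
      rw [← h2, hc, smul_add, smul_smul, mul_inv_cancel₀ hs, one_smul, add_comm,
        Polynomial.eval_C] at h3
      rw [eval_restrictLine, h3, Polynomial.eval_C_mul, Polynomial.eval_pow, Polynomial.eval_X,
        mul_comm]
    have h4 := eval_restrictLine q p h 0
    rw [h1] at h4
    simp only [Polynomial.eval_mul, Polynomial.eval_C, Polynomial.eval_pow, Polynomial.eval_X,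
      zero_pow hd, mul_zero, zero_smul, add_zero] at h4
    exact hq h4.symm
  · right
    obtain ⟨t, ht⟩ := IsAlgClosed.exists_root _ hdeg
    exact ⟨t, by rw [← eval_restrictLine]; exact ht⟩

/-- The contraction of the form of the foliation with a constant vector field. -/
noncomputable def contraction (F : PolynomialFoliation) (w : Fin 3 → ℂ) :
    MvPolynomial (Fin 3) ℂ := ∑ i, F.form i * C (w i)

theorem eval_contraction (F : PolynomialFoliation) (x w : Fin 3 → ℂ) :
    eval x (F.contraction w) = F.formAt x w := by simp [contraction, formAt]

theorem contraction_isHomogeneous {d : ℕ} (hd : ∀ i, (F.form i).IsHomogeneous d)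
    (w : Fin 3 → ℂ) : (F.contraction w).IsHomogeneous d :=
  IsHomogeneous.sum _ _ _ fun i _ => by
    rw [mul_comm]; exact (hd i).C_mul _

theorem eq_zero_of_dotProduct_frame (hli : LinearIndependent ℂ ![p, q, e]) {a : Fin 3 → ℂ}
    (h1 : a ⬝ᵥ p = 0) (h2 : a ⬝ᵥ q = 0) (h3 : a ⬝ᵥ e = 0) : a = 0 := by
  let b := basisOfLinearIndependentOfCardEqFinrank hli (by simp)
  have hb : ⇑b = ![p, q, e] := coe_basisOfLinearIndependentOfCardEqFinrank hli _
  ext i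
  have := b.sum_repr (Pi.single i 1)
  rw [hb, Fin.sum_univ_three] at this
  have h4 := congrArg (a ⬝ᵥ ·) this
  simpa [dotProduct_add, dotProduct_smul, h1, h2, h3] using h4.symm

theorem formAt_eq_zero_of_frame (hli : LinearIndependent ℂ ![p, q, e]) {x : Fin 3 → ℂ}
    (h1 : F.formAt x p = 0) (h2 : F.formAt x q = 0) (h3 : F.formAt x e = 0) (i : Fin 3) :
    eval x (F.form i) = 0 :=
  congrFun (eq_zero_of_dotProduct_frame (a := fun i => eval x (F.form i)) hli h1 h2 h3) i

/-- A projective line without singular points is not invariant. -/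
theorem IsPlaque.not_eventually_eq_zero (hli : LinearIndependent ℂ ![p, q, e]) (hr : 0 < r)
    (hreg : ∀ a b : ℂ, a • p + b • q ≠ 0 → ∃ i, eval (a • p + b • q) (F.form i) ≠ 0)
    (hf : F.IsPlaque p q e r ρ f) : ¬ ∀ᶠ u in 𝓝 (0 : ℂ), f u = 0 := by
  intro hf0
  obtain ⟨d, hd⟩ := F.exists_form_isHomogeneous
  have hq0 : ∀ᶠ u in 𝓝 (0 : ℂ), F.formAt (p + u • q) q = 0 := by
    filter_upwards [hf0.eventually_nhds, Metric.ball_mem_nhds (0 : ℂ) hr] with u hu hur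
    have h1 := hf u (by simpa using hur)
    have h2 : HasDerivAt f 0 u := (hasDerivAt_const u (0 : ℂ)).congr_of_eventuallyEq hu
    have h3 := h1.2.2.unique h2
    have h4 := h1.2.1
    rw [hu.self_of_nhds, zero_smul, add_zero] at h3 h4
    simpa [h4] using h3
  have hline : ∀ w, (∀ᶠ u in 𝓝 (0 : ℂ), F.formAt (p + u • q) w = 0) →
      restrictLine p q (F.contraction w) = 0 := by
    intro w hw
    refine Polynomial.eq_zero_of_infinite_isRoot _ (infinite_of_mem_nhds (0 : ℂ) ?_)
    filter_upwards [hw] with u hu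
    change Polynomial.eval u _ = 0
    rw [eval_restrictLine, eval_contraction, hu]
  have hp0 : ∀ᶠ u in 𝓝 (0 : ℂ), F.formAt (p + u • q) p = 0 := by
    filter_upwards [hq0] with u hu
    have := F.formAt_self (p + u • q)
    rwa [formAt_add, formAt_smul, hu, mul_zero, add_zero] at this
  have hall : ∀ w, (∀ᶠ u in 𝓝 (0 : ℂ), F.formAt (p + u • q) w = 0) →
      F.formAt q w = 0 ∧ ∀ u : ℂ, F.formAt (p + u • q) w = 0 := by
    intro w hw
    have h1 := hline w hw
    constructor
    · rw [← eval_contraction]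
      by_contra hne
      exact restrictLine_ne_zero (x := p) (contraction_isHomogeneous hd w) hne h1
    · intro u
      rw [← eval_contraction, ← eval_restrictLine, h1, Polynomial.eval_zero]
  have hlin := linearIndependent_triple_iff.1 hli
  -- Along an invariant line `ω` vanishes on `q`, and on `p` by the Euler relation. A zero of `ω(e)`
  -- on the line would then be a singular point, and for positive degree there is one.
  have hd0 : d = 0 := by
    by_contra hd0
    rcases exists_zero_on_line (contraction_isHomogeneous hd e) hd0 p q with h | ⟨t, h⟩
    · rw [eval_contraction] at h
      obtain ⟨i, hi⟩ := hreg 0 1 (fun h0 => by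
        simpa using hlin 0 1 0 (by simpa using h0))
      rw [zero_smul, one_smul, zero_add] at hi
      exact hi (formAt_eq_zero_of_frame hli (hall p hp0).1 (hall q hq0).1 h i)
    · rw [eval_contraction] at h
      obtain ⟨i, hi⟩ := hreg 1 t (fun h0 => by
        simpa using hlin 1 t 0 (by simpa using h0))
      rw [one_smul] at hi
      exact hi (formAt_eq_zero_of_frame hli ((hall p hp0).2 t) ((hall q hq0).2 t) h i)
  subst hd0
  -- In degree 0 the coefficients are constant, and the Euler relation at the basis vectors makes
  -- them zero.
  have hconst : ∀ i x y, eval x (F.form i) = eval y (F.form i) := by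
    intro i x y
    have h1 := (hd i).eval_smul 0 x
    have h2 := (hd i).eval_smul 0 y
    simp only [zero_smul, pow_zero, one_mul] at h1 h2
    rw [← h1, ← h2]
  obtain ⟨i, hi⟩ := hreg 1 0 (fun h0 => by simpa using hlin 1 0 0 (by simpa using h0))
  apply hi
  have := F.formAt_self (Pi.single i 1)
  rw [hconst i _ (Pi.single i 1)]
  simpa [formAt, Pi.single_apply] using this

/-- Near a point of a line without singular points that it meets in finitely many points, a
saturated set is a single plaque. -/
theorem IsSaturated.exists_plaque_on_line (hΛ : F.IsSaturated Λ)
    (hli : LinearIndependent ℂ ![p, q, e]) (he : F.formAt p e ≠ 0) (hp : p ∈ closure Λ)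
    (hreg : ∀ a b : ℂ, a • p + b • q ≠ 0 → ∃ i, eval (a • p + b • q) (F.form i) ≠ 0)
    (hfin : {t : ℂ | p + t • q ∈ Λ}.Finite) :
    p ∈ Λ ∧ ∃ r > 0, ∃ ρ : ℝ, ∃ f, f 0 = 0 ∧ F.IsPlaque p q e r ρ f ∧
      (¬ ∀ᶠ u in 𝓝 (0 : ℂ), f u = 0) ∧ (∀ u, ‖u‖ < r → p + u • q + f u • e ∈ Λ) ∧
      ∃ c u : (Fin 3 → ℂ) → ℂ, Tendsto c (𝓝[Λ] p) (𝓝 1) ∧ Tendsto u (𝓝[Λ] p) (𝓝 0) ∧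
      ∀ᶠ x in 𝓝[Λ] p, x = c x • (p + u x • q + f (u x) • e) := by
  obtain ⟨r, hr, ρ, f, hf0, hf, c, u, hc, hu, hev⟩ := hΛ.eventually_exists_plaque hli he
  have hne := hf.not_eventually_eq_zero hli hr hreg
  have hisol : ∀ᶠ w in 𝓝[≠] (0 : ℂ), f w ≠ 0 :=
    (hf.analyticAt hr).eventually_eq_zero_or_eventually_ne_zero.resolve_left hne
  have hisol2 : ∀ᶠ w in 𝓝[≠] (0 : ℂ), p + w • q ∉ Λ := by
    have h1 : ({t : ℂ | p + t • q ∈ Λ} \ {0})ᶜ ∈ 𝓝 (0 : ℂ) :=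
      (hfin.subset Set.sdiff_subset).isClosed.isOpen_compl.mem_nhds (by simp)
    filter_upwards [nhdsWithin_le_nhds h1, self_mem_nhdsWithin] with w hw hw0 hmem
    exact hw ⟨hmem, hw0⟩
  obtain ⟨η₀, hη₀, hball⟩ := Metric.eventually_nhds_iff_ball.1
    (eventually_nhdsWithin_iff.1 (hisol.and hisol2))
  -- On the closed disc of radius `η`, away from the centre, the plaque through `p` is off the line
  -- and the line has no points of `Λ`.
  obtain ⟨η, hη, hηr, hηη⟩ : ∃ η > 0, η < r ∧ η < η₀ :=
    ⟨min r η₀ / 2, by positivity, by linarith [min_le_left r η₀], by linarith [min_le_right r η₀]⟩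
  have hsph : ∀ w ∈ Metric.closedBall (0 : ℂ) η, w ≠ 0 → f w ≠ 0 ∧ p + w • q ∉ Λ := by
    intro w hw hw0
    refine hball w ?_ hw0
    rw [mem_closedBall_zero_iff] at hw
    rw [mem_ball_zero_iff]
    linarith
  have hcont : ContinuousOn (fun w => ‖f w‖) (Metric.sphere (0 : ℂ) η) :=
    (hf.differentiableOn.continuousOn.mono
      (Metric.sphere_subset_closedBall.trans (Metric.closedBall_subset_ball hηr))).norm
  obtain ⟨w₀, hw₀, hmin⟩ := (isCompact_sphere (0 : ℂ) η).exists_isMinOn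
    ((NormedSpace.sphere_nonempty).2 hη.le) hcont
  have hw₀0 : w₀ ≠ 0 := by
    rintro rfl
    rw [mem_sphere_zero_iff_norm, norm_zero] at hw₀
    exact hη.ne hw₀
  have hε : 0 < ‖f w₀‖ := norm_pos_iff.2 (hsph w₀ (Metric.sphere_subset_closedBall hw₀) hw₀0).1
  set ε := ‖f w₀‖
  -- A plaque `g` of `Λ` within `ε / 4` of `f` satisfies `‖g - g 0‖ ≥ ε / 2` on the circle, so by
  -- the quantitative open mapping theorem its image covers the ball of radius `ε / 4` about `g 0`,
  -- which contains 0. The zero of `g` gives a point of `Λ` on the line, so it is at the centre;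
  -- then `g 0 = f 0` and `g = f`.
  have hkey : ∀ᶠ x in 𝓝[Λ] p, x = c x • (p + u x • q + f (u x) • e) ∧
      ∀ w, ‖w‖ < r → p + w • q + f w • e ∈ Λ := by
    filter_upwards [hev (ε / 4) (by positivity)] with x hx
    obtain ⟨-, hur, g, hg, hxg, hmem, hclose, hlip⟩ := hx
    have hr0 : ‖(0 : ℂ)‖ < r := by simpa
    have hg0 : ‖g 0‖ < ε / 4 := by simpa [hf0] using hclose 0 hr0
    have hdiff : DiffContOnCl ℂ g (Metric.ball 0 η) := by
      refine (hg.differentiableOn.mono ?_).diffContOnCl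
      rw [closure_ball _ hη.ne']
      exact Metric.closedBall_subset_ball hηr
    have hbd : ∀ w ∈ Metric.sphere (0 : ℂ) η, ε / 2 ≤ ‖g w - g 0‖ := by
      intro w hw
      have h1 : ε ≤ ‖f w‖ := hmin hw
      have h2 := hclose w (by rw [mem_sphere_zero_iff_norm] at hw; linarith)
      have h3 := norm_sub_norm_le (f w) (f w - g w)
      have h4 := norm_sub_norm_le (g w) (g 0)
      rw [sub_sub_cancel, norm_sub_rev (f w)] at h3
      linarith
    have hfreq : ∃ᶠ w in 𝓝 (0 : ℂ), g w ≠ g 0 := by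
      intro hcon
      have h1 : Set.EqOn g (fun _ => g 0) (Metric.ball 0 r) :=
        (hg.differentiableOn.analyticOnNhd Metric.isOpen_ball).eqOn_of_preconnected_of_eventuallyEq
          analyticOnNhd_const (convex_ball _ _).isPreconnected (Metric.mem_ball_self hr)
          (hcon.mono fun w hw => not_not.1 hw)
      have h2 := hbd w₀ hw₀
      rw [h1 (by rw [mem_sphere_zero_iff_norm] at hw₀; simpa [hw₀] using hηr)] at h2
      simp only [sub_self, norm_zero] at h2
      linarith
    obtain ⟨w, hw, hgw⟩ := hdiff.ball_subset_image_closedBall hη hbd hfreq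
      (show (0 : ℂ) ∈ Metric.ball (g 0) (ε / 2 / 2) by
        rw [Metric.mem_ball, dist_comm, dist_zero_right]; linarith)
    have hwr : ‖w‖ < r := by rw [mem_closedBall_zero_iff] at hw; linarith
    have hw0 : w = 0 := by
      by_contra hw0
      refine (hsph w hw hw0).2 ?_
      have := hmem w hwr
      rwa [hgw, zero_smul, add_zero] at this
    rw [hw0] at hgw
    have hgf : ∀ w, ‖w‖ < r → g w = f w := by
      intro w hw
      have := hlip 0 w hr0 hw
      rw [hgw, hf0, sub_self, norm_zero, mul_zero, norm_le_zero_iff] at this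
      exact sub_eq_zero.1 this
    refine ⟨by rw [← hgf _ hur]; exact hxg, fun w hw => ?_⟩
    rw [← hgf w hw]
    exact hmem w hw
  have : (𝓝[Λ] p).NeBot := mem_closure_iff_nhdsWithin_neBot.1 hp
  obtain ⟨x, -, hmem⟩ := hkey.exists
  refine ⟨?_, r, hr, ρ, f, hf0, hf, hne, hmem, c, u, hc.mono_left nhdsWithin_le_nhds,
    hu.mono_left nhdsWithin_le_nhds, hkey.mono fun x hx => hx.1⟩
  have := hmem 0 (by simpa)
  simpa [hf0] using this

end PolynomialFoliation

/-! ### Branches at the line and the intersection polynomial -/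

namespace PolynomialFoliation

open scoped Matrix
open Filter Topology Asymptotics

variable {F : PolynomialFoliation} {p q e : Fin 3 → ℂ} {r ρ : ℝ} {f : ℂ → ℂ}
  {Λ : Set (Fin 3 → ℂ)} {l : Fin 3 → ℂ}

/-- Two nonzero linear forms are simultaneously nonzero on some vector. -/
theorem exists_dotProduct_ne_zero {a b : Fin 3 → ℂ} (ha : a ≠ 0) (hb : b ≠ 0) :
    ∃ e, a ⬝ᵥ e ≠ 0 ∧ b ⬝ᵥ e ≠ 0 := by
  obtain ⟨i, hi⟩ := Function.ne_iff.1 ha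
  obtain ⟨j, hj⟩ := Function.ne_iff.1 hb
  have hi : a ⬝ᵥ Pi.single i 1 ≠ 0 := by simpa using hi
  have hj : b ⬝ᵥ Pi.single j 1 ≠ 0 := by simpa using hj
  by_cases h1 : b ⬝ᵥ Pi.single i 1 = 0
  · by_cases h2 : a ⬝ᵥ Pi.single j 1 = 0
    · refine ⟨Pi.single i 1 + Pi.single j 1, ?_, ?_⟩
      · rwa [dotProduct_add, h2, add_zero]
      · rwa [dotProduct_add, h1, zero_add]
    · exact ⟨_, h2, hj⟩
  · exact ⟨_, hi, h1⟩

/-- A point of a line without singular points is the first vector of a frame whose second vector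
spans the line with it and whose last vector is transverse to the foliation and to the line. -/
theorem exists_frame_on_line (hl : l ≠ 0) (hp : l ⬝ᵥ p = 0) (hq : l ⬝ᵥ q = 0)
    (hli : LinearIndependent ℂ ![p, q]) (hreg : ∃ i, eval p (F.form i) ≠ 0) :
    ∃ e, LinearIndependent ℂ ![p, q, e] ∧ F.formAt p e ≠ 0 ∧ l ⬝ᵥ e ≠ 0 := by
  obtain ⟨e, h1, h2⟩ := exists_dotProduct_ne_zero (a := fun i => eval p (F.form i)) (b := l)
    (fun h => hreg.elim fun i hi => hi (congrFun h i)) hl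
  refine ⟨e, linearIndependent_triple_iff.2 fun a b c habc => ?_, h1, h2⟩
  have h3 := congrArg (l ⬝ᵥ ·) habc
  simp only [dotProduct_add, dotProduct_smul, hp, hq, smul_eq_mul, mul_zero, zero_add,
    dotProduct_zero] at h3
  have hc : c = 0 := (mul_eq_zero.1 h3).resolve_right h2
  rw [hc, zero_smul, add_zero] at habc
  have := LinearIndependent.pair_iff.1 hli a b habc
  exact ⟨this.1, this.2, hc⟩

/-- The local branch of a saturated set at a point `p` of a line without singular points that it
meets in finitely many points; `m` is the order of contact of the branch with the line. -/
theorem IsSaturated.exists_branch (hΛ : F.IsSaturated Λ) (hl : l ≠ 0) (hlp : l ⬝ᵥ p = 0)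
    (hlq : l ⬝ᵥ q = 0) (hli : LinearIndependent ℂ ![p, q])
    (hreg : ∀ x, x ≠ 0 → l ⬝ᵥ x = 0 → ∃ i, eval x (F.form i) ≠ 0)
    (hfin : {t : ℂ | p + t • q ∈ Λ}.Finite) (hp : p ∈ closure Λ) :
    p ∈ Λ ∧ ∃ (m : ℕ) (φ : ℂ → Fin 3 → ℂ), AnalyticAt ℂ φ 0 ∧ φ 0 = p ∧
      (∀ᶠ u in 𝓝 0, φ u ∈ Λ) ∧ (∀ᶠ u in 𝓝[≠] 0, l ⬝ᵥ φ u ≠ 0) ∧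
      (∀ G : MvPolynomial (Fin 3) ℂ, (∀ x ∈ Λ, eval x G = 0) →
        (fun u : ℂ => eval (p + u • q) G) =O[𝓝 0] fun u => u ^ m) ∧
      ∀ (N k : ℕ) (G : MvPolynomial (Fin 3) ℂ), 0 < k → G.IsHomogeneous N →
        ((k * m + 1 : ℕ) : ℕ∞) ≤ analyticOrderAt (fun u => eval (φ u) G) 0 →
        Tendsto (fun x => eval x G / (l ⬝ᵥ x) ^ k) (𝓝[Λ] p) (𝓝 0) := by
  have hp0 : p ≠ 0 := by
    rintro rfl
    simpa using LinearIndependent.pair_iff.1 hli 1 0 (by simp)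
  obtain ⟨e, hli3, he, hle⟩ := exists_frame_on_line hl hlp hlq hli (hreg p hp0 hlp)
  have hreg' : ∀ a b : ℂ, a • p + b • q ≠ 0 → ∃ i, eval (a • p + b • q) (F.form i) ≠ 0 :=
    fun a b h => hreg _ h (by simp [dotProduct_add, dotProduct_smul, hlp, hlq])
  obtain ⟨hpΛ, r, hr, ρ, f, hf0, hf, hne, hmem, c, u, hc, hu, hx⟩ :=
    hΛ.exists_plaque_on_line hli3 he hp hreg' hfin
  have hfa := hf.analyticAt hr
  set φ : ℂ → Fin 3 → ℂ := fun u => p + u • q + f u • e with hφ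
  have hφa : AnalyticAt ℂ φ 0 :=
    (analyticAt_const.add (analyticAt_id.smul analyticAt_const)).add (hfa.smul analyticAt_const)
  have hφ0 : φ 0 = p := by simp [hφ, hf0]
  have hlφ : ∀ u, l ⬝ᵥ φ u = f u * l ⬝ᵥ e := fun u => by
    simp [hφ, dotProduct_add, dotProduct_smul, hlp, hlq]
  have hball := Metric.ball_mem_nhds (0 : ℂ) hr
  -- Since `l(φ u) = f(u) l(e)` with `l(e) ≠ 0`, the order of `f` is the order of contact with the
  -- line.
  obtain ⟨m, hm⟩ := ENat.ne_top_iff_exists.1 (mt analyticOrderAt_eq_top.1 hne)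
  obtain ⟨h, hha, hh0, hfh⟩ := hfa.analyticOrderAt_eq_natCast.1 hm.symm
  simp only [sub_zero, smul_eq_mul] at hfh
  refine ⟨hpΛ, m, φ, hφa, hφ0, ?_, ?_, ?_, ?_⟩
  · filter_upwards [hball] with u hu
    exact hmem u (by simpa using hu)
  · filter_upwards [hfa.eventually_eq_zero_or_eventually_ne_zero.resolve_left hne] with u hu
    rw [hlφ]
    exact mul_ne_zero hu hle
  · intro G hG
    obtain ⟨K, t, ht, hK⟩ := ((analyticAt_eval G p).contDiffAt (n := 1)).exists_lipschitzOnWith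
    have hψ : Tendsto (fun u : ℂ => p + u • q) (𝓝 0) (𝓝 p) := by
      have : Continuous fun u : ℂ => p + u • q := by fun_prop
      simpa using this.tendsto 0
    have hφt : Tendsto φ (𝓝 0) (𝓝 p) := by simpa [hφ0] using hφa.continuousAt.tendsto
    -- `G` vanishes at `φ u`, whose distance to `p + u q` is `‖f u‖ ‖e‖`.
    have h1 : (fun u : ℂ => eval (p + u • q) G) =O[𝓝 0] f := by
      refine IsBigO.of_bound (K * ‖e‖) ?_
      filter_upwards [hψ.eventually ht, hφt.eventually ht, hball] with u h1 h2 h3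
      have h4 := hK.dist_le_mul _ h1 _ h2
      rw [hG _ (hmem u (by simpa using h3)), dist_zero_right, dist_eq_norm] at h4
      refine h4.trans (le_of_eq ?_)
      rw [hφ, sub_add_cancel_left, norm_neg, norm_smul]
      ring
    have h2 : f =O[𝓝 0] fun u => u ^ m := by
      have : (fun u => u ^ m * h u) =O[𝓝 0] fun u : ℂ => u ^ m * 1 :=
        (isBigO_refl _ _).mul (hha.continuousAt.isBigO_one ℂ)
      simp only [mul_one] at this
      exact this.congr' (hfh.mono fun u hu => hu.symm) EventuallyEq.rfl
    exact h1.trans h2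
  · intro N k G hk hG hord
    have hGa : AnalyticAt ℂ (fun u => eval (φ u) G) 0 := (analyticAt_eval G (φ 0)).comp hφa
    obtain ⟨g, hga, hg⟩ := (natCast_le_analyticOrderAt hGa).1 hord
    simp only [sub_zero, smul_eq_mul] at hg
    -- The numerator has order at least `k m + 1` and the denominator exactly `k m`, so one factor
    -- `w` survives.
    have hquot : ∀ᶠ w in 𝓝 (0 : ℂ), eval (φ w) G / (f w * l ⬝ᵥ e) ^ k =
        w * g w / (h w * l ⬝ᵥ e) ^ k := by
      filter_upwards [hg, hfh, hha.continuousAt.eventually_ne hh0] with w h1 h2 h3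
      rw [h1, h2]
      by_cases hw : w = 0
      · simp [hw]
      · field_simp
        ring
    have hlim : Tendsto (fun w => eval (φ w) G / (f w * l ⬝ᵥ e) ^ k) (𝓝 0) (𝓝 0) := by
      have h1 : ContinuousAt (fun w => w * g w / (h w * l ⬝ᵥ e) ^ k) 0 :=
        (continuousAt_id.mul hga.continuousAt).div ((hha.continuousAt.mul continuousAt_const).pow k)
          (pow_ne_zero _ (mul_ne_zero hh0 hle))
      have h2 := h1.tendsto
      simp only [zero_mul, zero_div] at h2
      exact h2.congr' (hquot.mono fun w hw => hw.symm)
    have hlim2 : Tendsto (fun x => c x ^ N / c x ^ k *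
        (eval (φ (u x)) G / (f (u x) * l ⬝ᵥ e) ^ k)) (𝓝[Λ] p) (𝓝 0) := by
      have := ((hc.pow N).div (hc.pow k) (by simp)).mul (hlim.comp hu)
      simpa using this
    refine hlim2.congr' ?_
    filter_upwards [hx] with x hx
    have h1 : eval x G = c x ^ N * eval (φ (u x)) G := by
      conv_lhs => rw [hx]
      exact hG.eval_smul _ _
    have h2 : l ⬝ᵥ x = c x * (f (u x) * l ⬝ᵥ e) := by
      conv_lhs => rw [hx]
      rw [dotProduct_smul, smul_eq_mul]
      congr 1
      exact hlφ _
    rw [h1, h2, mul_pow (c x), mul_div_mul_comm]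

/-- A polynomial that is `O((z - t) ^ m)` at `t` is divisible by `(X - t) ^ m`. -/
theorem pow_dvd_of_isBigO {g : Polynomial ℂ} {t : ℂ} {m : ℕ}
    (h : (fun u : ℂ => g.eval (t + u)) =O[𝓝 0] fun u => u ^ m) :
    (Polynomial.X - Polynomial.C t) ^ m ∣ g := by
  by_cases hg : g = 0
  · simp [hg]
  rw [← Polynomial.le_rootMultiplicity_iff hg]
  by_contra! hlt
  obtain ⟨s, hs, hnd⟩ := Polynomial.exists_eq_pow_rootMultiplicity_mul_and_not_dvd g hg t
  set n := Polynomial.rootMultiplicity t g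
  apply hnd
  rw [Polynomial.dvd_iff_isRoot, Polynomial.IsRoot.def]
  obtain ⟨C, hC⟩ := h.bound
  have h1 : ∀ᶠ u in 𝓝[≠] (0 : ℂ), ‖s.eval (t + u)‖ ≤ C * ‖u‖ ^ (m - n) := by
    filter_upwards [nhdsWithin_le_nhds hC, self_mem_nhdsWithin] with u hu hu0
    have hu0 : u ≠ 0 := hu0
    rw [hs] at hu
    simp only [Polynomial.eval_mul, Polynomial.eval_pow, Polynomial.eval_sub, Polynomial.eval_X,
      Polynomial.eval_C, add_sub_cancel_left, norm_mul, norm_pow] at hu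
    have hpos : 0 < ‖u‖ ^ n := by positivity
    refine le_of_mul_le_mul_left ?_ hpos
    calc _ ≤ _ := hu
      _ = C * (‖u‖ ^ n * ‖u‖ ^ (m - n)) := by rw [← pow_add, Nat.add_sub_cancel' hlt.le]
      _ = _ := by ring
  have h2 : Tendsto (fun u : ℂ => ‖s.eval (t + u)‖) (𝓝[≠] 0) (𝓝 ‖s.eval t‖) := by
    have : Continuous fun u : ℂ => ‖s.eval (t + u)‖ :=
      (s.continuous.comp (continuous_const.add continuous_id)).norm
    simpa using (this.tendsto 0).mono_left nhdsWithin_le_nhds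
  have h3 : Tendsto (fun u : ℂ => C * ‖u‖ ^ (m - n)) (𝓝[≠] 0) (𝓝 0) := by
    have : Continuous fun u : ℂ => C * ‖u‖ ^ (m - n) := by fun_prop
    have h4 := (this.tendsto 0).mono_left (nhdsWithin_le_nhds (s := {0}ᶜ))
    simpa [(Nat.sub_pos_of_lt hlt).ne'] using h4
  have h5 := le_of_tendsto_of_tendsto h2 h3 h1
  exact norm_le_zero_iff.1 h5

/-- The derivatives of `u ↦ G(φ(u))` at the origin, as linear functions of `G`. -/
noncomputable def jetCoeff (φ : ℂ → Fin 3 → ℂ) (hφ : AnalyticAt ℂ φ 0) (j : ℕ) :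
    MvPolynomial (Fin 3) ℂ →ₗ[ℂ] ℂ where
  toFun G := iteratedDeriv j (fun u => eval (φ u) G) 0
  map_add' G H := by
    simp only [map_add]
    exact iteratedDeriv_fun_add ((analyticAt_eval G (φ 0)).comp hφ).contDiffAt
      ((analyticAt_eval H (φ 0)).comp hφ).contDiffAt
  map_smul' c G := by
    simp only [smul_eval, RingHom.id_apply, smul_eq_mul]
    exact iteratedDeriv_const_mul_field c _

/-- A saturated set that meets a line without singular points in finitely many points: the
polynomial `R` describes the intersection with multiplicities, and the homogeneous polynomials of
degree `N` that vanish on the set have codimension at most `(deg R) N + c`. -/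
theorem IsSaturated.exists_intersection_polynomial (hΛ : F.IsSaturated Λ) (hl : l ≠ 0)
    {w₁ w₂ : Fin 3 → ℂ} (h₁ : l ⬝ᵥ w₁ = 0) (h₂ : l ⬝ᵥ w₂ = 0)
    (hli : LinearIndependent ℂ ![w₁, w₂])
    (hspan : ∀ x, l ⬝ᵥ x = 0 → ∃ a b : ℂ, x = a • w₁ + b • w₂)
    (hreg : ∀ x, x ≠ 0 → l ⬝ᵥ x = 0 → ∃ i, eval x (F.form i) ≠ 0)
    (hw₂ : w₂ ∉ Λ) (hfin : {t : ℂ | w₁ + t • w₂ ∈ Λ}.Finite) :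
    ∃ (R : Polynomial ℂ) (c : ℕ), R ≠ 0 ∧ (∀ t, R.eval t = 0 → w₁ + t • w₂ ∈ Λ) ∧
      (∀ G : MvPolynomial (Fin 3) ℂ, (∀ x ∈ Λ, eval x G = 0) → R ∣ restrictLine w₁ w₂ G) ∧
      ∀ N, ∃ V : Submodule ℂ (MvPolynomial (Fin 3) ℂ), V ≤ homogeneousSubmodule (Fin 3) ℂ N ∧
        Module.finrank ℂ (homogeneousSubmodule (Fin 3) ℂ N) ≤
          Module.finrank ℂ V + (R.natDegree * N + c) ∧
        ∀ G ∈ V, ∀ x ∈ Λ, eval x G = 0 := by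
  classical
  obtain ⟨d, hd⟩ := F.exists_form_isHomogeneous
  have hli' := LinearIndependent.pair_iff.1 hli
  have hliT : ∀ t : ℂ, LinearIndependent ℂ ![w₁ + t • w₂, w₂] := fun t => by
    rw [LinearIndependent.pair_iff]
    intro a b hab
    have := hli' a (a * t + b) (by rw [← hab]; module)
    refine ⟨this.1, ?_⟩
    simpa [this.1] using this.2
  have hlT : ∀ t : ℂ, l ⬝ᵥ (w₁ + t • w₂) = 0 := fun t => by
    simp [dotProduct_add, dotProduct_smul, h₁, h₂]
  have hfinT : ∀ t : ℂ, {u : ℂ | w₁ + t • w₂ + u • w₂ ∈ Λ}.Finite := fun t => by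
    refine (hfin.preimage (f := fun u => t + u) (add_right_injective t).injOn).subset fun u hu => ?_
    change w₁ + (t + u) • w₂ ∈ Λ
    rw [add_smul, ← add_assoc]
    exact hu
  have hbr := fun t => hΛ.exists_branch hl (hlT t) h₂ (hliT t) hreg (hfinT t)
  -- `w₂` is the point at infinity of the parametrization `t ↦ w₁ + t w₂`; exchanging `w₁` and `w₂`
  -- inverts the parameter and brings it to 0.
  have hw₂c : w₂ ∉ closure Λ := by
    intro hc
    refine hw₂ (hΛ.exists_branch (q := w₁) hl h₂ h₁ ?_ hreg ?_ hc).1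
    · exact LinearIndependent.pair_symm_iff.1 hli
    · refine ((hfin.image (fun t => t⁻¹)).union (Set.finite_singleton 0)).subset fun t ht => ?_
      by_cases h0 : t = 0
      · right; exact h0
      · left
        refine ⟨t⁻¹, ?_, inv_inv t⟩
        have := hΛ.smul_mem _ ht t⁻¹ (inv_ne_zero h0)
        rwa [smul_add, smul_smul, inv_mul_cancel₀ h0, one_smul, add_comm] at this
  have hpts : ∀ p ∈ closure Λ, p ≠ 0 → l ⬝ᵥ p = 0 →
      ∃ a t : ℂ, a ≠ 0 ∧ p = a • (w₁ + t • w₂) ∧ w₁ + t • w₂ ∈ Λ := by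
    intro p hp hp0 hlp
    obtain ⟨a, b, rfl⟩ := hspan p hlp
    have ha : a ≠ 0 := by
      rintro rfl
      have hb : b ≠ 0 := by rintro rfl; simp at hp0
      apply hw₂c
      have := hΛ.smul_mem_closure hp (inv_ne_zero hb)
      rwa [zero_smul, zero_add, smul_smul, inv_mul_cancel₀ hb, one_smul] at this
    have heq : a • w₁ + b • w₂ = a • (w₁ + (b / a) • w₂) := by
      rw [smul_add, smul_smul, mul_div_cancel₀ _ ha]
    refine ⟨a, b / a, ha, heq, (hbr (b / a) ?_).1⟩
    have := hΛ.smul_mem_closure hp (inv_ne_zero ha)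
    rwa [heq, smul_smul, inv_mul_cancel₀ ha, one_smul] at this
  have hbr' : ∀ t : {t : ℂ // w₁ + t • w₂ ∈ Λ}, _ := fun t => (hbr t.1 (subset_closure t.2)).2
  choose m φ hφa hφ0 hφΛ hφl hvan htend using hbr'
  have : Fintype {t : ℂ // w₁ + t • w₂ ∈ Λ} := hfin.fintype
  -- Each point of `Λ` on the line is counted with its order of contact.
  set R : Polynomial ℂ := ∏ t, (Polynomial.X - Polynomial.C t.1) ^ m t with hR
  have hRm : R.Monic := Polynomial.monic_prod_of_monic _ _ fun t _ =>
    (Polynomial.monic_X_sub_C _).pow _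
  have hRd : R.natDegree = ∑ t, m t := by
    rw [hR, Polynomial.natDegree_prod_of_monic _ _ fun t _ => (Polynomial.monic_X_sub_C _).pow _]
    simp
  refine ⟨R, R.natDegree * (d + 1) + Fintype.card {t : ℂ // w₁ + t • w₂ ∈ Λ}, hRm.ne_zero,
    ?_, ?_, ?_⟩
  · intro t ht
    rw [hR, Polynomial.eval_prod, Finset.prod_eq_zero_iff] at ht
    obtain ⟨s, -, hs⟩ := ht
    rw [Polynomial.eval_pow] at hs
    have := eq_zero_of_pow_eq_zero hs
    simp only [Polynomial.eval_sub, Polynomial.eval_X, Polynomial.eval_C, sub_eq_zero] at this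
    rw [this]
    exact s.2
  · intro G hG
    refine Finset.prod_dvd_of_coprime (fun s _ t _ hst => ?_) fun t _ => ?_
    · exact (Polynomial.pairwise_coprime_X_sub_C Subtype.val_injective hst).pow
    · refine pow_dvd_of_isBigO ((hvan t G hG).congr_left fun u => ?_)
      rw [eval_restrictLine, add_smul, add_assoc]
  · intro N
    set k := N + d + 1 with hk
    let S := homogeneousSubmodule (Fin 3) ℂ N
    -- `k * m t + 1` jet conditions at each point make `k * R.natDegree` plus the number of points
    -- in total; with `k = N + d + 1` this is linear in `N` with slope `R.natDegree`.
    let J : S →ₗ[ℂ] ((Σ t : {t : ℂ // w₁ + t • w₂ ∈ Λ}, Fin (k * m t + 1)) → ℂ) :=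
      LinearMap.pi fun tj => jetCoeff (φ tj.1) (hφa tj.1) tj.2 ∘ₗ S.subtype
    refine ⟨(LinearMap.ker J).map S.subtype, Submodule.map_subtype_le _ _, ?_, ?_⟩
    · have e1 := LinearMap.finrank_range_add_finrank_ker J
      have e2 := Submodule.finrank_le (LinearMap.range J)
      have e3 : Module.finrank ℂ ((LinearMap.ker J).map S.subtype) =
          Module.finrank ℂ (LinearMap.ker J) :=
        (Submodule.equivMapOfInjective _ S.injective_subtype _).finrank_eq.symm
      rw [Module.finrank_fintype_fun_eq_card, Fintype.card_sigma] at e2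
      simp only [Fintype.card_fin, Finset.sum_add_distrib, ← Finset.mul_sum, ← hRd,
        Finset.sum_const, Finset.card_univ, smul_eq_mul, mul_one] at e2
      rw [e3, ← e1]
      have e4 : k * R.natDegree = R.natDegree * N + R.natDegree * (d + 1) := by rw [hk]; ring
      omega
    · rintro _ ⟨⟨G, hG⟩, hker, rfl⟩ x hx
      have hord : ∀ t, ((k * m t + 1 : ℕ) : ℕ∞) ≤
          analyticOrderAt (fun u => eval (φ t u) G) 0 := by
        intro t
        have hGa : AnalyticAt ℂ (fun u => eval (φ t u) G) 0 :=
          (analyticAt_eval G (φ t 0)).comp (hφa t)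
        rw [natCast_le_analyticOrderAt_iff_iteratedDeriv_eq_zero hGa]
        intro j hj
        exact congrFun (LinearMap.mem_ker.1 hker) ⟨t, ⟨j, hj⟩⟩
      have hoff : ∀ y ∈ Λ, l ⬝ᵥ y ≠ 0 → eval y G = 0 := by
        intro y hy hly
        refine hΛ.eval_eq_zero_of_tendsto hd hG ?_ hy hly
        intro p hp hp0 hlp
        obtain ⟨a, t, ha, rfl, htΛ⟩ := hpts p hp hp0 hlp
        have h1 := htend ⟨t, htΛ⟩ N k G (by omega) hG (hord _)
        have h2 : Tendsto (fun x : Fin 3 → ℂ => a⁻¹ • x) (𝓝[Λ] (a • (w₁ + t • w₂)))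
            (𝓝[Λ] (w₁ + t • w₂)) := by
          refine tendsto_nhdsWithin_iff.2 ⟨?_, ?_⟩
          · have := ((continuous_const_smul (a⁻¹ : ℂ)).tendsto
              (a • (w₁ + t • w₂))).mono_left (nhdsWithin_le_nhds (s := Λ))
            rwa [smul_smul, inv_mul_cancel₀ ha, one_smul] at this
          · filter_upwards [self_mem_nhdsWithin] with z hz
            exact hΛ.smul_mem z hz _ (inv_ne_zero ha)
        have h3 := (h1.comp h2).const_mul (a ^ N / a ^ k)
        rw [mul_zero] at h3
        refine h3.congr fun z => ?_
        simp only [Function.comp]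
        rw [IsHomogeneous.eval_smul hG, dotProduct_smul, smul_eq_mul, mul_pow, inv_pow,
          inv_pow, ← hk]
        field_simp
      by_cases hlx : l ⬝ᵥ x = 0
      -- A point of `Λ` on the line is a limit of points of its branch off the line, where `G` is
      -- already known to vanish.
      · obtain ⟨a, t, ha, rfl, htΛ⟩ := hpts x (subset_closure hx) (hΛ.ne_zero x hx) hlx
        change eval _ G = 0
        rw [IsHomogeneous.eval_smul hG]
        have hcont : Tendsto (fun u => eval (φ ⟨t, htΛ⟩ u) G) (𝓝[≠] 0)
            (𝓝 (eval (w₁ + t • w₂) G)) := by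
          have h1 : ContinuousAt (fun u => eval (φ ⟨t, htΛ⟩ u) G) 0 :=
            (continuous_eval_vec G).continuousAt.comp (hφa ⟨t, htΛ⟩).continuousAt
          have h2 := h1.tendsto
          rw [hφ0] at h2
          exact h2.mono_left nhdsWithin_le_nhds
        have hzero : Tendsto (fun u => eval (φ ⟨t, htΛ⟩ u) G) (𝓝[≠] 0) (𝓝 0) := by
          refine tendsto_const_nhds.congr' ?_
          filter_upwards [nhdsWithin_le_nhds (hφΛ ⟨t, htΛ⟩), hφl ⟨t, htΛ⟩] with u hu hlu
          exact (hoff _ hu hlu).symm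
        rw [tendsto_nhds_unique hcont hzero, mul_zero]
      · exact hoff x hx hlx

end PolynomialFoliation

/-! ### Cones over leaves, least equations and invariant curves -/

namespace PolynomialFoliation

open scoped Matrix
open Filter Topology

variable {F : PolynomialFoliation} {Λ : Set (Fin 3 → ℂ)} {l : Fin 3 → ℂ}

/-- The cone over a set of points of the projective plane. -/
def cone (L : Set CP2) : Set (Fin 3 → ℂ) := {x | ∃ h : x ≠ 0, Projectivization.mk ℂ x h ∈ L}

theorem eval_rep_eq_zero_iff {G : MvPolynomial (Fin 3) ℂ} {N : ℕ} (hG : G.IsHomogeneous N)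
    {x : Fin 3 → ℂ} (hx : x ≠ 0) :
    eval (Projectivization.mk ℂ x hx).rep G = 0 ↔ eval x G = 0 := by
  obtain ⟨a, ha⟩ := Projectivization.exists_smul_eq_mk_rep ℂ x hx
  rw [← ha, Units.smul_def, hG.eval_smul]
  simp

theorem mk_notMem_singularSet_iff {x : Fin 3 → ℂ} (hx : x ≠ 0) :
    Projectivization.mk ℂ x hx ∉ F.singularSet ↔ ∃ i, eval x (F.form i) ≠ 0 := by
  obtain ⟨d, hd⟩ := F.exists_form_isHomogeneous
  simp only [singularSet, Set.mem_ofPred_eq, eval_rep_eq_zero_iff (hd _) hx, not_forall, ne_eq]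

theorem OnCommonDisc.notMem_singularSet {p q : CP2} (h : F.OnCommonDisc p q) :
    q ∉ F.singularSet := by
  obtain ⟨γ, hγ, -, t, ht, h0, rfl⟩ := h
  exact (mk_notMem_singularSet_iff h0).2 (hγ.regular t ht)

theorem disjoint_leaf_singularSet {p q : CP2} (hp : p ∉ F.singularSet) (hq : q ∈ F.leaf p) :
    q ∉ F.singularSet := by
  rcases Relation.ReflTransGen.cases_tail hq with rfl | ⟨c, -, hc⟩
  · exact hp
  · exact hc.notMem_singularSet

theorem isSaturated_cone_leaf {p : CP2} (hp : p ∉ F.singularSet) :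
    F.IsSaturated (cone (F.leaf p)) where
  ne_zero x hx := hx.1
  smul_mem x := by
    rintro ⟨hx, hmem⟩ c hc
    refine ⟨smul_ne_zero hc hx, ?_⟩
    rwa [(Projectivization.mk_eq_mk_iff' ℂ _ _ (smul_ne_zero hc hx) hx).2 ⟨c, rfl⟩]
  regular x := by
    rintro ⟨hx, hmem⟩
    exact (mk_notMem_singularSet_iff hx).1 (disjoint_leaf_singularSet hp hmem)
  disc γ hγ s hs t ht := by
    rintro ⟨hx, hmem⟩
    exact ⟨hγ.ne_zero t ht, Relation.ReflTransGen.tail hmem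
      ⟨γ, hγ, ⟨s, hs, hx, rfl⟩, ⟨t, ht, hγ.ne_zero t ht, rfl⟩⟩⟩

theorem IsSaturated.exists_plaque (hΛ : F.IsSaturated Λ) {x : Fin 3 → ℂ} (hx : x ∈ Λ) :
    ∃ q e, LinearIndependent ℂ ![x, q, e] ∧ F.formAt x e ≠ 0 ∧
      ∃ r > 0, ∃ ρ : ℝ, ∃ f, f 0 = 0 ∧ F.IsPlaque x q e r ρ f ∧
        ∀ u, ‖u‖ < r → x + u • q + f u • e ∈ Λ := by
  obtain ⟨q, e, hli, he⟩ := exists_frame (hΛ.ne_zero x hx) (hΛ.regular x hx)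
  obtain ⟨r, hr, ρ, ⟨δ, hδ, -, hex⟩, -⟩ := exists_plaques he q
  obtain ⟨f, hf0, hf⟩ := hex 0 0 (by simpa) (by simpa)
  refine ⟨q, e, hli, he, r, hr, ρ, f, hf0, hf, fun u hu => ?_⟩
  exact hΛ.plaque_mem hli hf (u₀ := 0) (by simpa) hu (by simpa [hf0] using hx)

/-- A polynomial that vanishes on a saturated set except at finitely many points of the projective
plane vanishes on the whole set. -/
theorem IsSaturated.eval_eq_zero_of_finite (hΛ : F.IsSaturated Λ) {B : Set CP2} (hB : B.Finite)
    {H : MvPolynomial (Fin 3) ℂ}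
    (hH : ∀ x ∈ Λ, ∀ h : x ≠ 0, Projectivization.mk ℂ x h ∉ B → eval x H = 0) :
    ∀ x ∈ Λ, eval x H = 0 := by
  intro x hx
  obtain ⟨q, e, hli, -, r, hr, ρ, f, hf0, hf, hmem⟩ := hΛ.exists_plaque hx
  set φ : ℂ → Fin 3 → ℂ := fun u => x + u • q + f u • e
  have hφ : ∀ u, φ u ≠ 0 := fun u => add_smul_add_smul_ne_zero hli _ _
  -- Distinct parameters of a plaque give distinct projective points, so only finitely many of them
  -- fall in `B`, and continuity handles these.
  have hinj : Function.Injective fun u => Projectivization.mk ℂ (φ u) (hφ u) := by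
    intro u v huv
    obtain ⟨a, ha⟩ := (Projectivization.mk_eq_mk_iff' ℂ _ _ _ _).1 huv
    have h1 := linearIndependent_triple_iff.1 hli (a - 1) (a * v - u) (a * f v - f u) (by
      have : a • φ v - φ u = 0 := sub_eq_zero.2 ha
      rw [← this]
      module)
    have h2 : a = 1 := sub_eq_zero.1 h1.1
    have h3 := h1.2.1
    rw [h2, one_mul, sub_eq_zero] at h3
    exact h3.symm
  have hfin := hB.preimage (hinj.injOn (s := _))
  have h1 : ∀ᶠ u in 𝓝[≠] (0 : ℂ), eval (φ u) H = 0 := by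
    have h2 : ((fun u => Projectivization.mk ℂ (φ u) (hφ u)) ⁻¹' B \ {0})ᶜ ∈ 𝓝 (0 : ℂ) :=
      (hfin.subset Set.sdiff_subset).isClosed.isOpen_compl.mem_nhds (by simp)
    filter_upwards [nhdsWithin_le_nhds h2, self_mem_nhdsWithin,
      nhdsWithin_le_nhds (Metric.ball_mem_nhds (0 : ℂ) hr)] with u hu hu0 hur
    exact hH _ (hmem u (by simpa using hur)) (hφ u) fun hB => hu ⟨hB, hu0⟩
  have h3 : Tendsto (fun u => eval (φ u) H) (𝓝[≠] 0) (𝓝 (eval x H)) := by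
    have hφc : ContinuousAt φ 0 := by
      have := (hf.analyticAt hr).continuousAt
      fun_prop
    have h4 : Tendsto (fun u => eval (φ u) H) (𝓝 0) (𝓝 (eval (φ 0) H)) :=
      ((continuous_eval_vec H).continuousAt.comp hφc).tendsto
    rw [show φ 0 = x by simp [φ, hf0]] at h4
    exact h4.mono_left nhdsWithin_le_nhds
  exact tendsto_nhds_unique h3 (tendsto_const_nhds.congr' (h1.mono fun u hu => hu.symm))

/-- A homogeneous polynomial of least degree that vanishes on a saturated set divides all
homogeneous polynomials that vanish on it. -/
theorem IsSaturated.dvd_of_minimal (hΛ : F.IsSaturated Λ) {G : MvPolynomial (Fin 3) ℂ} {D : ℕ}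
    (hG : G.IsHomogeneous D) (hG0 : G ≠ 0) (hGΛ : ∀ x ∈ Λ, eval x G = 0)
    (hmin : ∀ (H : MvPolynomial (Fin 3) ℂ) (k : ℕ), H.IsHomogeneous k → H ≠ 0 →
      (∀ x ∈ Λ, eval x H = 0) → D ≤ k)
    {H : MvPolynomial (Fin 3) ℂ} {b : ℕ} (hH : H.IsHomogeneous b)
    (hHΛ : ∀ x ∈ Λ, eval x H = 0) : G ∣ H := by
  by_cases hH0 : H = 0
  · simp [hH0]
  -- Off the finitely many common zeros of the coprime cofactors, the common factor `c` must vanish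
  -- on `Λ`, hence it vanishes on all of `Λ`. Minimality gives `c` the full degree `D`, so `G'` is a
  -- constant.
  obtain ⟨G', H', c, hrel, rfl, rfl⟩ := UniqueFactorizationMonoid.exists_reduced_factors G hG0 H
  obtain ⟨k, a, hka, hc, hG'⟩ := hG.exists_of_mul hG0
  obtain ⟨k', b', -, -, hH'⟩ := hH.exists_of_mul hH0
  have hfin := finite_common_zeros hG' hH' (right_ne_zero_of_mul hG0) (right_ne_zero_of_mul hH0) hrel
  have hcΛ := hΛ.eval_eq_zero_of_finite hfin (H := c) (by
    intro x hx h0 hB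
    by_contra hcx
    apply hB
    have h1 := hGΛ x hx
    have h2 := hHΛ x hx
    rw [map_mul] at h1 h2
    exact ⟨(eval_rep_eq_zero_iff hG' h0).2 ((mul_eq_zero.1 h1).resolve_left hcx),
      (eval_rep_eq_zero_iff hH' h0).2 ((mul_eq_zero.1 h2).resolve_left hcx)⟩)
  have hD := hmin c k hc (left_ne_zero_of_mul hG0) hcΛ
  obtain rfl : a = 0 := by omega
  have hC := totalDegree_eq_zero_iff_eq_C.1 ((totalDegree_zero_iff_isHomogeneous _).2 hG')
  have hunit : IsUnit G' := by
    rw [hC]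
    refine (isUnit_iff_ne_zero.2 fun h0 => ?_).map C
    rw [h0, C_0] at hC
    exact right_ne_zero_of_mul hG0 hC
  exact mul_dvd_mul_left c hunit.dvd

theorem hasDerivAt_eval (G : MvPolynomial (Fin 3) ℂ) {γ : ℂ → Fin 3 → ℂ} {γ' : Fin 3 → ℂ} {t : ℂ}
    (h : HasDerivAt γ γ' t) :
    HasDerivAt (fun t => eval (γ t) G) (∑ i, eval (γ t) (pderiv i G) * γ' i) t := by
  have hi := hasDerivAt_pi.1 h
  induction G using MvPolynomial.induction_on with
  | C a => simpa using hasDerivAt_const t a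
  | add p q hp hq =>
    simp only [map_add, add_mul, Finset.sum_add_distrib]
    exact hp.add hq
  | mul_X p j hp =>
    have := hp.mul (hi j)
    simp only [map_mul, eval_X, Derivation.leibniz, pderiv_X, smul_eq_mul, map_add]
    refine this.congr_deriv ?_
    simp only [add_mul, Finset.sum_add_distrib, Finset.sum_mul]
    rw [add_comm]
    congr 1
    · rw [Finset.sum_eq_single j]
      · simp
      · intro i _ hij; simp [hij.symm]
      · simp
    · exact Finset.sum_congr rfl fun i _ => by ring

/-- The coefficients of `dG ∧ ω`, where `ω` is the form of the foliation. -/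
noncomputable def wedge (F : PolynomialFoliation) (G : MvPolynomial (Fin 3) ℂ) (i j : Fin 3) :
    MvPolynomial (Fin 3) ℂ := pderiv i G * F.form j - pderiv j G * F.form i

/-- At a point of `Λ` both `dG` and `ω` kill the radial vector (for `dG` by Euler's identity, since
`G` vanishes there) and the tangent of the plaque. Two covectors of `ℂ³` with these two independent
vectors in their kernels are proportional. -/
theorem IsSaturated.eval_wedge_eq_zero (hΛ : F.IsSaturated Λ) {G : MvPolynomial (Fin 3) ℂ} {D : ℕ}
    (hG : G.IsHomogeneous D) (hGΛ : ∀ x ∈ Λ, eval x G = 0) (i j : Fin 3) :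
    ∀ x ∈ Λ, eval x (F.wedge G i j) = 0 := by
  intro x hx
  obtain ⟨q, e, hli, he, r, hr, ρ, f, hf0, hf, hmem⟩ := hΛ.exists_plaque hx
  set g : Fin 3 → ℂ := fun i => eval x (pderiv i G) with hg
  set a : Fin 3 → ℂ := fun i => eval x (F.form i) with ha
  have hae : a ⬝ᵥ e ≠ 0 := he
  have hax : a ⬝ᵥ x = 0 := F.formAt_self x
  have hgx : g ⬝ᵥ x = 0 := by
    have := congrArg (eval x) hG.sum_X_mul_pderiv
    simp only [map_sum, map_mul, eval_X, nsmul_eq_mul, hGΛ x hx, mul_zero] at this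
    rw [← this]
    exact Finset.sum_congr rfl fun i _ => mul_comm _ _
  have hr0 : ‖(0 : ℂ)‖ < r := by simpa
  have hf' := (hf 0 hr0).2.2
  rw [hf0, zero_smul, zero_smul, add_zero, add_zero] at hf'
  have hgq : g ⬝ᵥ (q + (-F.formAt x q / F.formAt x e) • e) = 0 := by
    have h1 : HasDerivAt (fun u : ℂ => x + u • q + f u • e)
        (q + (-F.formAt x q / F.formAt x e) • e) 0 := by
      have := (((hasDerivAt_id (0 : ℂ)).smul_const q).const_add x).add (hf'.smul_const e)
      rw [one_smul] at this
      exact this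
    have h2 := hasDerivAt_eval G h1
    have h3 : HasDerivAt (fun u : ℂ => eval (x + u • q + f u • e) G) 0 0 := by
      refine (hasDerivAt_const (0 : ℂ) (0 : ℂ)).congr_of_eventuallyEq ?_
      filter_upwards [Metric.ball_mem_nhds (0 : ℂ) hr] with u hu
      exact hGΛ _ (hmem u (by simpa using hu))
    have h4 := h2.unique h3
    simp only [hf0, zero_smul, add_zero] at h4
    exact h4
  have hae' : F.formAt x e = a ⬝ᵥ e := rfl
  have haq' : F.formAt x q = a ⬝ᵥ q := rfl
  rw [dotProduct_add, dotProduct_smul, smul_eq_mul, hae', haq'] at hgq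
  have hzero : g - ((g ⬝ᵥ e) / (a ⬝ᵥ e)) • a = 0 := by
    refine eq_zero_of_dotProduct_frame hli ?_ ?_ ?_
    · rw [sub_dotProduct, smul_dotProduct, hgx, hax]; simp
    · rw [sub_dotProduct, smul_dotProduct, smul_eq_mul]
      linear_combination hgq
    · rw [sub_dotProduct, smul_dotProduct, smul_eq_mul, div_mul_cancel₀ _ hae, sub_self]
  have hgi : ∀ i, g i = (g ⬝ᵥ e) / (a ⬝ᵥ e) * a i := fun i => by
    have := congrFun hzero i
    simpa [sub_eq_zero] using this
  simp only [wedge, map_sub, map_mul]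
  change g i * a j - g j * a i = 0
  rw [hgi i, hgi j]
  ring

/-- If `G` divides `dG ∧ ω`, then the curve `G = 0` is invariant. -/
theorem IsTangentDisc.eval_eq_zero {G : MvPolynomial (Fin 3) ℂ}
    (hdvd : ∀ i j, G ∣ F.wedge G i j) {γ : ℂ → Fin 3 → ℂ} (hγ : F.IsTangentDisc γ)
    {s t : ℂ} (hs : s ∈ Metric.ball (0 : ℂ) 1) (ht : t ∈ Metric.ball (0 : ℂ) 1)
    (h : eval (γ s) G = 0) : eval (γ t) G = 0 := by
  choose K hK using hdvd
  have hγa := hγ.differentiableOn.analyticOnNhd Metric.isOpen_ball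
  have hha : AnalyticOnNhd ℂ (fun t => eval (γ t) G) (Metric.ball 0 1) := fun t ht =>
    (analyticAt_eval G (γ t)).comp (hγa t ht)
  obtain ⟨j, hj⟩ := hγ.regular s hs
  have hja : AnalyticAt ℂ (fun t => eval (γ t) (F.form j)) s :=
    (analyticAt_eval (F.form j) (γ s)).comp (hγa s hs)
  let κ : ℂ → ℂ := fun t => ∑ i, eval (γ t) (K i j) * deriv γ t i
  have hκ : AnalyticAt ℂ κ s := by
    refine Finset.analyticAt_fun_sum _ fun i _ => ?_
    have h1 : AnalyticAt ℂ (fun t => eval (γ t) (K i j)) s :=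
      (analyticAt_eval (K i j) (γ s)).comp (hγa s hs)
    have h2 : AnalyticAt ℂ (fun t => deriv γ t i) s :=
      ((ContinuousLinearMap.proj (R := ℂ) (φ := fun _ : Fin 3 => ℂ) i).analyticAt _).comp
        (hγa s hs).deriv
    exact h1.mul h2
  -- Contracting `dG ∧ ω = G K` with the tangent vector, which `ω` kills, gives `ωⱼ (G ∘ γ)' = (G ∘
  -- γ) κ`.
  have hode : (fun t => eval (γ t) (F.form j)) * deriv (fun t => eval (γ t) G) =ᶠ[𝓝 s]
      (fun t => eval (γ t) G) * κ := by
    filter_upwards [Metric.isOpen_ball.mem_nhds hs] with t ht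
    have hd : HasDerivAt γ (deriv γ t) t :=
      ((hγ.differentiableOn t ht).differentiableAt (Metric.isOpen_ball.mem_nhds ht)).hasDerivAt
    have htan := hγ.tangent t ht
    simp only [Pi.mul_apply, (hasDerivAt_eval G hd).deriv, κ]
    have h1 : ∀ i, eval (γ t) (F.form j) * (eval (γ t) (pderiv i G) * deriv γ t i) =
        eval (γ t) (pderiv j G) * (eval (γ t) (F.form i) * deriv γ t i) +
          eval (γ t) G * (eval (γ t) (K i j) * deriv γ t i) := by
      intro i
      have := congrArg (eval (γ t)) (hK i j)
      simp only [wedge, map_sub, map_mul] at this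
      linear_combination (deriv γ t i) * this
    rw [Finset.mul_sum, Finset.sum_congr rfl fun i _ => h1 i, Finset.sum_add_distrib,
      ← Finset.mul_sum, htan, mul_zero, zero_add, Finset.mul_sum]
  -- As `ωⱼ` is nonzero at `γ s`, the derivative of `G ∘ γ` vanishes at `s` at least to the order of
  -- `G ∘ γ`. Differentiation lowers a finite positive order by one, so the order is infinite.
  have hord := analyticOrderAt_congr hode
  rw [analyticOrderAt_mul hja (hha s hs).deriv, analyticOrderAt_mul (hha s hs) hκ,
    hja.analyticOrderAt_eq_zero.2 hj, zero_add] at hord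
  have hder := (hha s hs).analyticOrderAt_deriv_add_one
  simp only [h, sub_zero] at hder
  have htop : analyticOrderAt (fun t => eval (γ t) G) s = ⊤ := by
    by_contra hne
    obtain ⟨n, hn⟩ := ENat.ne_top_iff_exists.1 hne
    rw [hord, ← hn] at hder
    have h1 : ((n : ℕ∞) + 1) ≤ n := by
      calc ((n : ℕ∞) + 1) ≤ n + analyticOrderAt κ s + 1 := by gcongr; exact le_self_add
        _ = n := hder
    exact absurd h1 (by exact_mod_cast Nat.not_succ_le_self n)
  exact hha.eqOn_zero_of_preconnected_of_eventuallyEq_zero (convex_ball _ _).isPreconnected hs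
    (analyticOrderAt_eq_top.1 htop) ht

/-- A nonempty saturated set meets every line without singular points. -/
theorem IsSaturated.eq_empty_of_disjoint_line (hΛ : F.IsSaturated Λ) (hl : l ≠ 0)
    (hreg : ∀ x, x ≠ 0 → l ⬝ᵥ x = 0 → ∃ i, eval x (F.form i) ≠ 0)
    (hline : ∀ p, p ≠ 0 → l ⬝ᵥ p = 0 → ∃ q, l ⬝ᵥ q = 0 ∧ LinearIndependent ℂ ![p, q])
    (hdisj : ∀ x ∈ Λ, l ⬝ᵥ x ≠ 0) : Λ = ∅ := by
  refine Set.eq_empty_of_forall_notMem fun y hy => ?_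
  obtain ⟨d, hd⟩ := F.exists_form_isHomogeneous
  -- The maximum principle is applied to `G = 1`. Its limit condition is vacuous, since by
  -- `exists_branch` a point of the closure on the line would belong to `Λ`.
  have := hΛ.eval_eq_zero_of_tendsto (l := l) hd (isHomogeneous_one (Fin 3) ℂ) (fun p hp hp0 hlp => by
    obtain ⟨q, hlq, hli⟩ := hline p hp0 hlp
    refine absurd hlp (hdisj p (hΛ.exists_branch hl hlp hlq hli hreg ?_ hp).1)
    convert Set.finite_empty
    refine Set.eq_empty_of_forall_notMem fun t ht => hdisj _ ht ?_
    simp [dotProduct_add, dotProduct_smul, hlp, hlq]) hy (hdisj y hy)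
  simp at this

end PolynomialFoliation

/-! ### Algebraicity -/

namespace PolynomialFoliation

open scoped Matrix
open Filter Topology

variable {F : PolynomialFoliation} {Λ : Set (Fin 3 → ℂ)} {l : Fin 3 → ℂ}

/-- A plane in `ℂ³` is the kernel of a linear form. -/
theorem exists_equation {W : Submodule ℂ (Fin 3 → ℂ)} (hW : Module.finrank ℂ W = 2) :
    ∃ l : Fin 3 → ℂ, l ≠ 0 ∧ ∀ x, l ⬝ᵥ x = 0 ↔ x ∈ W := by
  have hlt : W < ⊤ := by
    refine lt_top_iff_ne_top.2 fun h => ?_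
    rw [h, finrank_top] at hW
    simp at hW
  obtain ⟨f, hf, hle⟩ := Submodule.exists_le_ker_of_lt_top W hlt
  have hfl : ∀ x, (fun i => f (Pi.single i 1)) ⬝ᵥ x = f x := by
    intro x
    conv_rhs => rw [pi_eq_sum_univ' x]
    simp [dotProduct, mul_comm]
  have hker : W = LinearMap.ker f := by
    refine Submodule.eq_of_le_of_finrank_le hle ?_
    have h1 := LinearMap.finrank_range_add_finrank_ker f
    have h2 : LinearMap.range f = ⊤ := LinearMap.range_eq_top.2 (LinearMap.surjective hf)
    rw [h2, finrank_top] at h1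
    simp at h1
    omega
  refine ⟨fun i => f (Pi.single i 1), fun h0 => hf ?_, fun x => ?_⟩
  · ext i
    simpa using congrFun h0 i
  · rw [hfl, hker, LinearMap.mem_ker]

/-- A nonzero vector of a plane is the last vector of a basis of this plane. -/
theorem exists_basis_of_plane {W : Submodule ℂ (Fin 3 → ℂ)} (hW : Module.finrank ℂ W = 2)
    {p : Fin 3 → ℂ} (hp : p ≠ 0) (hpW : p ∈ W) :
    ∃ q ∈ W, LinearIndependent ℂ ![q, p] ∧ ∀ x ∈ W, ∃ a b : ℂ, x = a • q + b • p := by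
  obtain ⟨q, hq⟩ := exists_linearIndependent_pair_of_one_lt_finrank (R := ℂ) (M := W)
    (by omega) (x := ⟨p, hpW⟩) (fun h => hp (congrArg Subtype.val h))
  refine ⟨q, q.2, ?_, fun x hx => ?_⟩
  · rw [LinearIndependent.pair_iff] at hq ⊢
    intro s t hst
    have := hq t s (Subtype.ext (by simpa [add_comm] using hst))
    exact ⟨this.2, this.1⟩
  · let b := basisOfLinearIndependentOfCardEqFinrank hq (by simp [hW])
    have hb : ⇑b = ![⟨p, hpW⟩, q] := coe_basisOfLinearIndependentOfCardEqFinrank hq _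
    have := congrArg Subtype.val (b.sum_repr ⟨x, hx⟩)
    rw [hb, Fin.sum_univ_two] at this
    refine ⟨b.repr ⟨x, hx⟩ 1, b.repr ⟨x, hx⟩ 0, ?_⟩
    rw [add_comm]
    exact this.symm

/-- A nonempty saturated set that meets a projective line without singular points in finitely many
points is the regular part of an algebraic curve. -/
theorem IsSaturated.exists_algebraic_equation (hΛ : F.IsSaturated Λ) (hne : Λ.Nonempty)
    {W : Submodule ℂ (Fin 3 → ℂ)} (hW : Module.finrank ℂ W = 2)
    (hreg : ∀ x ∈ W, x ≠ 0 → ∃ i, eval x (F.form i) ≠ 0)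
    (hfin : {P : CP2 | ∃ x ∈ Λ, x ∈ W ∧ ∃ h : x ≠ 0, Projectivization.mk ℂ x h = P}.Finite) :
    ∃ (G : MvPolynomial (Fin 3) ℂ) (D : ℕ), G ≠ 0 ∧ G.IsHomogeneous D ∧
      ∀ x, x ∈ Λ ↔ x ≠ 0 ∧ (∃ i, eval x (F.form i) ≠ 0) ∧ eval x G = 0 := by
  obtain ⟨l, hl, hlW⟩ := exists_equation hW
  have hreg' : ∀ x, x ≠ 0 → l ⬝ᵥ x = 0 → ∃ i, eval x (F.form i) ≠ 0 :=
    fun x hx hlx => hreg x ((hlW x).1 hlx) hx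
  have hfinT : ∀ w₁ ∈ W, ∀ w₂ ∈ W, LinearIndependent ℂ ![w₁, w₂] →
      {t : ℂ | w₁ + t • w₂ ∈ Λ}.Finite := by
    intro w₁ h₁ w₂ h₂ hli
    have hli' := LinearIndependent.pair_iff.1 hli
    have h0 : ∀ t : ℂ, w₁ + t • w₂ ≠ 0 := fun t h => by
      simpa using hli' 1 t (by simpa using h)
    have hinj : Function.Injective fun t : ℂ => Projectivization.mk ℂ (w₁ + t • w₂) (h0 t) := by
      intro s t hst
      obtain ⟨a, ha⟩ := (Projectivization.mk_eq_mk_iff' ℂ _ _ _ _).1 hst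
      have h1 := hli' (a - 1) (a * t - s) (by
        rw [← sub_eq_zero.2 ha]
        module)
      have h2 : a = 1 := sub_eq_zero.1 h1.1
      have h3 := h1.2
      rw [h2, one_mul, sub_eq_zero] at h3
      exact h3.symm
    exact (hfin.preimage hinj.injOn).subset fun t ht =>
      ⟨_, ht, W.add_mem h₁ (W.smul_mem t h₂), h0 t, rfl⟩
  have hkey : ∀ w₂ ∈ W, w₂ ≠ 0 → w₂ ∉ Λ → ∃ w₁ ∈ W, LinearIndependent ℂ ![w₁, w₂] ∧
      (∀ x ∈ W, ∃ a b : ℂ, x = a • w₁ + b • w₂) ∧ _ := fun w₂ h₂ h0 hw₂ => by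
    obtain ⟨w₁, h₁, hli, hspan⟩ := exists_basis_of_plane hW h0 h₂
    exact ⟨w₁, h₁, hli, hspan, hΛ.exists_intersection_polynomial hl ((hlW _).2 h₁) ((hlW _).2 h₂) hli
      (fun x hx => hspan x ((hlW x).1 hx)) hreg' hw₂ (hfinT w₁ h₁ w₂ h₂ hli)⟩
  have hexists : ∃ D, ∃ G : MvPolynomial (Fin 3) ℂ, G.IsHomogeneous D ∧ G ≠ 0 ∧
      ∀ x ∈ Λ, eval x G = 0 := by
    obtain ⟨w₂, h₂, h0, hw₂⟩ : ∃ w₂ ∈ W, w₂ ≠ 0 ∧ w₂ ∉ Λ := by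
      obtain ⟨p, hpW, hp0⟩ := Submodule.exists_mem_ne_zero_of_ne_bot (p := W) (by
        rintro rfl; simp at hW)
      obtain ⟨q, hqW, hli, -⟩ := exists_basis_of_plane hW hp0 hpW
      obtain ⟨t, ht⟩ := (hfinT q hqW p hpW hli).infinite_compl.nonempty
      refine ⟨q + t • p, W.add_mem hqW (W.smul_mem t hpW), fun h => ?_, ht⟩
      simpa using LinearIndependent.pair_iff.1 hli 1 t (by simpa using h)
    obtain ⟨w₁, -, -, -, R, c, -, -, -, hV⟩ := hkey w₂ h₂ h0 hw₂
    -- Large enough for the quadratic dimension `(N + 1) * (N + 2) / 2` to exceed the linear number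
    -- of conditions.
    set N := 2 * R.natDegree + 2 * c with hN
    obtain ⟨V, hVS, hdim, hVΛ⟩ := hV N
    have hVne : V ≠ ⊥ := by
      rintro rfl
      have h1 := finrank_homogeneousSubmodule N
      rw [finrank_bot, zero_add] at hdim
      have h2 : 2 * (R.natDegree * N + c) < (N + 1) * (N + 2) := by
        have : 2 * R.natDegree * N ≤ N * N := Nat.mul_le_mul_right N (by omega)
        nlinarith
      omega
    obtain ⟨G, hGV, hG0⟩ := Submodule.exists_mem_ne_zero_of_ne_bot hVne
    exact ⟨N, G, hVS hGV, hG0, hVΛ G hGV⟩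
  classical
  obtain ⟨G, hG, hG0, hGΛ⟩ := Nat.find_spec hexists
  set D := Nat.find hexists with hD
  have hmin : ∀ (H : MvPolynomial (Fin 3) ℂ) (k : ℕ), H.IsHomogeneous k → H ≠ 0 →
      (∀ x ∈ Λ, eval x H = 0) → D ≤ k := fun H k hH hH0 hHΛ =>
    Nat.find_min' hexists ⟨H, hH, hH0, hHΛ⟩
  have hdiv := fun (H : MvPolynomial (Fin 3) ℂ) (b : ℕ) (hH : H.IsHomogeneous b) =>
    hΛ.dvd_of_minimal hG hG0 hGΛ hmin hH
  -- Otherwise `l` divides `G`, and the quotient, of smaller degree, vanishes on `Λ` off the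
  -- finitely many points of the line, hence on all of `Λ`.
  obtain ⟨w₂, h₂, hGw₂⟩ : ∃ w₂ ∈ W, eval w₂ G ≠ 0 := by
    by_contra! hc
    obtain ⟨G', rfl⟩ := linearForm_dvd hl (G := G) fun x hx => by
      rw [eval_linearForm] at hx
      exact hc x ((hlW x).1 hx)
    obtain ⟨k, a, hka, hk, ha⟩ := hG.exists_of_mul hG0
    have hk1 := hk.inj_right (linearForm_isHomogeneous l) (left_ne_zero_of_mul hG0)
    have hG'Λ := hΛ.eval_eq_zero_of_finite hfin (H := G') (by
      intro x hx h0 hB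
      have h1 := hGΛ x hx
      rw [map_mul] at h1
      refine (mul_eq_zero.1 h1).resolve_left fun h2 => hB ⟨x, hx, ?_, h0, rfl⟩
      rw [eval_linearForm] at h2
      exact (hlW x).1 h2)
    have := hmin G' a ha (right_ne_zero_of_mul hG0) hG'Λ
    omega
  have hw₂Λ : w₂ ∉ Λ := fun h => hGw₂ (hGΛ w₂ h)
  have hD0 : D ≠ 0 := by
    intro h0
    obtain ⟨x, hx⟩ := hne
    rw [h0] at hG
    have h1 := hG.eval_smul 0 x
    have h2 := hG.eval_smul 0 w₂
    rw [zero_smul, pow_zero, one_mul] at h1 h2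
    rw [← h2, h1] at hGw₂
    exact hGw₂ (hGΛ x hx)
  have hw₂0 : w₂ ≠ 0 := by
    rintro rfl
    have := hG.eval_smul 0 0
    rw [zero_smul, zero_pow hD0, zero_mul] at this
    exact hGw₂ this
  obtain ⟨w₁, h₁, hli, hspan, R, c, hR0, hRroot, hRdvd, hV⟩ := hkey w₂ h₂ hw₂0 hw₂Λ
  -- In degree `D + M` the multiples of `G` have codimension growing like `D * M`, but they contain
  -- `V`, of codimension at most `n * (D + M) + c`. For `D > n` the chosen `M` is too large for
  -- both.
  have hdeg : D ≤ R.natDegree := by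
    by_contra! hlt
    set n := R.natDegree
    set M := n * D + c + 1 with hM
    obtain ⟨V, hVS, hdim, hVΛ⟩ := hV (D + M)
    have hle : V ≤ multiples G M := fun H hH =>
      mem_multiples_of_dvd hG (hVS hH) (hdiv H _ (hVS hH) (hVΛ H hH))
    have e1 := Submodule.finrank_mono hle
    rw [finrank_multiples hG0] at e1
    have e2 := finrank_homogeneousSubmodule (D + M)
    have e3 := finrank_homogeneousSubmodule M
    have e4 : (D + M + 1) * (D + M + 2) ≤ (M + 1) * (M + 2) + 2 * (n * (D + M) + c) := by omega
    have e5 : (n + 1) * M ≤ D * M := Nat.mul_le_mul_right M hlt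
    nlinarith
  -- The restriction of `G` to the line is divisible by `R` and has degree at most `D ≤
  -- R.natDegree`, so it is a constant multiple of `R`, whose roots all give points of `Λ`.
  have hGline : ∀ x ∈ W, x ≠ 0 → eval x G = 0 → x ∈ Λ := by
    intro x hxW hx0 hGx
    obtain ⟨a, b, rfl⟩ := hspan x hxW
    have ha : a ≠ 0 := by
      rintro rfl
      rw [zero_smul, zero_add] at hx0 hGx
      rw [hG.eval_smul] at hGx
      have hb : b ≠ 0 := by rintro rfl; simp at hx0
      exact mul_ne_zero (pow_ne_zero _ hb) hGw₂ hGx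
    have heq : a • w₁ + b • w₂ = a • (w₁ + (b / a) • w₂) := by
      rw [smul_add, smul_smul, mul_div_cancel₀ _ ha]
    rw [heq] at hGx ⊢
    refine hΛ.smul_mem _ (hRroot _ ?_) a ha
    rw [hG.eval_smul] at hGx
    have hroot := (mul_eq_zero.1 hGx).resolve_left (pow_ne_zero _ ha)
    rw [← eval_restrictLine] at hroot
    have hg0 := restrictLine_ne_zero (x := w₁) hG hGw₂
    have hgd := natDegree_restrictLine_le w₁ w₂ hG
    obtain ⟨S, hS⟩ := hRdvd G hGΛ
    rw [hS] at hg0 hgd hroot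
    rw [Polynomial.natDegree_mul hR0 (right_ne_zero_of_mul hg0)] at hgd
    have hS0 : S.natDegree = 0 := by omega
    rw [Polynomial.eq_C_of_natDegree_eq_zero hS0, Polynomial.eval_mul, Polynomial.eval_C] at hroot
    refine (mul_eq_zero.1 hroot).resolve_right fun h => right_ne_zero_of_mul hg0 ?_
    rw [Polynomial.eq_C_of_natDegree_eq_zero hS0, h, Polynomial.C_0]
  obtain ⟨d, hd⟩ := F.exists_form_isHomogeneous
  have hwedge : ∀ i j, G ∣ F.wedge G i j := fun i j =>
    hdiv _ (D - 1 + d) ((hG.pderiv.mul (hd j)).sub (hG.pderiv.mul (hd i)))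
      (hΛ.eval_wedge_eq_zero hG hGΛ i j)
  -- The regular part of `G = 0` outside `Λ` is itself saturated. By `hGline` it misses the line, so
  -- it is empty.
  have hrest : F.IsSaturated
      {x | x ≠ 0 ∧ (∃ i, eval x (F.form i) ≠ 0) ∧ eval x G = 0 ∧ x ∉ Λ} := by
    refine ⟨fun x hx => hx.1, ?_, fun x hx => hx.2.1, ?_⟩
    · rintro x ⟨hx0, ⟨i, hi⟩, hGx, hxΛ⟩ a ha
      refine ⟨smul_ne_zero ha hx0, ⟨i, ?_⟩, ?_, fun h => hxΛ ?_⟩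
      · rw [(hd i).eval_smul]
        exact mul_ne_zero (pow_ne_zero _ ha) hi
      · rw [hG.eval_smul, hGx, mul_zero]
      · have := hΛ.smul_mem _ h a⁻¹ (inv_ne_zero ha)
        rwa [smul_smul, inv_mul_cancel₀ ha, one_smul] at this
    · rintro γ hγ s hs t ht ⟨-, -, hGs, hsΛ⟩
      exact ⟨hγ.ne_zero t ht, hγ.regular t ht, hγ.eval_eq_zero hwedge hs ht hGs,
        fun h => hsΛ (hΛ.disc γ hγ t ht s hs h)⟩
  have hempty := hrest.eq_empty_of_disjoint_line hl hreg' (fun p hp0 hlp => by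
    obtain ⟨q, hqW, hli, -⟩ := exists_basis_of_plane hW hp0 ((hlW p).1 hlp)
    exact ⟨q, (hlW q).2 hqW, LinearIndependent.pair_symm_iff.1 hli⟩) (by
    rintro x ⟨hx0, -, hGx, hxΛ⟩ hlx
    exact hxΛ (hGline x ((hlW x).1 hlx) hx0 hGx))
  refine ⟨G, D, hG0, hG, fun x => ⟨fun hx => ⟨hΛ.ne_zero x hx, hΛ.regular x hx, hGΛ x hx⟩, ?_⟩⟩
  rintro ⟨hx0, hxr, hGx⟩
  by_contra hxΛ
  exact Set.eq_empty_iff_forall_notMem.1 hempty x ⟨hx0, hxr, hGx, hxΛ⟩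

end PolynomialFoliation

theorem lemma12 (F : PolynomialFoliation) (L : Set CP2) (hL : F.IsLeaf L)
    (hna : ¬ F.IsAlgebraicLeaf L) (T : Set CP2) (hT : IsProjectiveLine T)
    (hsing : Disjoint T F.singularSet) : (L ∩ T).Infinite := by
  intro hfin
  obtain ⟨W, hW, rfl⟩ := hT
  obtain ⟨p, hp, hLp⟩ := id hL
  have hΛ := PolynomialFoliation.isSaturated_cone_leaf hp
  rw [← hLp] at hΛ
  have hmk : ∀ x (h : x ≠ 0), Projectivization.mk ℂ x h ∈ projectiveLocus W ↔ x ∈ W := by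
    intro x h
    change (Projectivization.mk ℂ x h).submodule ≤ W ↔ _
    rw [Projectivization.submodule_mk, Submodule.span_singleton_le_iff_mem]
  have hpL : p ∈ L := by rw [hLp]; exact Relation.ReflTransGen.refl
  obtain ⟨G, D, hG0, hG, hGL⟩ := hΛ.exists_algebraic_equation
    ⟨p.rep, p.rep_nonzero, by rwa [p.mk_rep]⟩ hW
    (fun x hx h0 => (PolynomialFoliation.mk_notMem_singularSet_iff h0).1
      (Set.disjoint_left.1 hsing ((hmk x h0).2 hx)))
    (hfin.subset (by
      rintro _ ⟨x, ⟨h0, hx⟩, hxW, -, rfl⟩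
      exact ⟨hx, (hmk x h0).2 hxW⟩))
  refine hna ⟨hL, G, D, hG0, hG, ?_⟩
  ext P
  induction P using Projectivization.ind with
  | h x hx =>
    have h1 : Projectivization.mk ℂ x hx ∈ L ↔ x ∈ PolynomialFoliation.cone L :=
      ⟨fun h => ⟨hx, h⟩, fun h => h.2⟩
    rw [h1, hGL x, Set.mem_sdiff, PolynomialFoliation.mk_notMem_singularSet_iff hx]
    change _ ↔ eval _ G = 0 ∧ _
    rw [PolynomialFoliation.eval_rep_eq_zero_iff hG hx]
    tauto
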